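/- **Setting.** Let $\{\varepsilon_j\}_{j\in\mathbb Z}$ be i.i.d. copies of a random vector $\varepsilon$ in $\mathbb R^d$ with mean zero and unit covariance matrix. Let $\theta_0\in\Theta\subseteq\mathbb R^v$, and for $\theta\in\Theta$ let $\Sigma(\theta;x_1,x_2,\dots)$ be a positive definite $d\times d$ matrix depending measurably on the sequence $x_1,x_2,\dots$ in $\mathbb R^d$. Let $\{X_j\}_{j\in\mathbb Z}$ be a strictly stationary process with $X_j=\Sigma_j^{1/2}(\theta_0)\varepsilon_j$ almost surely, where $\Sigma_j(\theta)=\Sigma(\theta;X_{j-1},X_{j-2},\dots)$, and with $X_j$ measurable with respect to the $\sigma$-field generated by $\{\varepsilon_u:u\le j\}$. Matrix square roots are the symmetric ones. For fixed initial values $\widetilde X_0,\widetilde X_{-1},\dots$ put $\widetilde\Sigma_j(\theta)=\Sigma(\theta;X_{j-1},\dots,X_1,\widetilde X_0,\widetilde X_{-1},\dots)$, $j\ge1$. Let $\widehat\theta_n$ be an estimator with values in $\Theta$. For a matrix, $\|A\|=\sum_{k,j}|a_{kj}|$; for a vector, $\|\cdot\|$ is the Euclidean norm. Derivatives in $\theta$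 are taken relative to $\Theta$ (they are ordinary derivatives at interior points). Assume the following. * (A.1) $\sqrt n(\widehat\theta_n-\theta_0)=n^{-1/2}\sum_{j=1}^nL_j+o_{\mathbb P}(1)$, where $L_j=h_jg_j$, $g_j=g(\varepsilon_j)$ is a vector of $d^2$ measurable functions with $\mathbb E g_j=0$ and $\mathbb E(g_j^\top g_j)<\infty$, and $h_j=h(\varepsilon_{j-1},\varepsilon_{j-2},\dots)$ is a $v\times d^2$ matrix of measurable functions with $\mathbb E\|h_jh_j^\top\|^2<\infty$ (the functions $g,h$ may depend on $\theta_0$). * (A.2) There is a constant $C>0$ such that almost surely $\sup_{\theta\in\Theta}\|\widetilde\Sigma_j^{-1/2}(\theta)\|\le C$ and $\sup_{\theta\in\Theta}\|\Sigma_j^{-1/2}(\theta)\|\le C$ for all $j\ge1$. * (A.3) There are $\varrho\in(0,1)$ and an almost surely finite $C>0$ (possibly random, not depending on $j$) such that almost surely $\sup_{\theta\in\Theta}\|\Sigma_j^{1/2}(\theta)-\widetilde\Sigma_j^{1/2}(\theta)\|\le C\varrho^j$ for all $j\ge1$. * (A.4) $\mathbb E\|X_j\|^\varsigma<\infty$ and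 $\mathbb E\|\Sigma_j^{1/2}(\theta_0)\|^\varsigma<\infty$ for some $\varsigma>0$. * (A.5) For every sequence $x_1,x_2,\dots$ in $\mathbb R^d$, the function $\theta\mapsto\Sigma^{1/2}(\theta;x_1,x_2,\dots)$ is twice continuously differentiable on $\Theta$. * (A.6) For some neighbourhood $V$ of $\theta_0$ there are $p>1$, $q>2$, $r>1$ with $2p^{-1}+2r^{-1}=1$ and $4q^{-1}+2r^{-1}=1$ such that $$\mathbb E\sup_{\theta\in V\cap\Theta}\Big\|\sum_{k,\ell=1}^v\Sigma_j^{-1/2}(\theta)\frac{\partial^2\Sigma_j^{1/2}(\theta)}{\partial\theta_k\partial\theta_\ell}\Big\|^p<\infty,\qquad \mathbb E\sup_{\theta\in V\cap\Theta}\Big\|\sum_{k=1}^v\Sigma_j^{-1/2}(\theta)\frac{\partial\Sigma_j^{1/2}(\theta)}{\partial\theta_k}\Big\|^q<\infty,$$ $$\mathbb E\sup_{\theta\in V\cap\Theta}\big\|\Sigma_j^{1/2}(\theta_0)\Sigma_j^{-1/2}(\theta)\big\|^r<\infty.$$ For $\beta>1$ let $m(t)=\exp(\|t\|^2/2)$,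 $w_\beta(t)=\exp(-\beta\|t\|^2)$, $\widetilde\varepsilon_j(\theta)=\widetilde\Sigma_j^{-1/2}(\theta)X_j$, $M_n^G(t)=\frac1n\sum_{j=1}^n\exp\big(t^\top\widetilde\varepsilon_j(\widehat\theta_n)\big)$ and $$T_{n,\beta}^G=n\int_{\mathbb R^d}\big(M_n^G(t)-m(t)\big)^2w_\beta(t)\,\mathrm dt .$$ **Theorem.** In this setting, suppose that $\varepsilon$ has an absolutely continuous distribution and that $M_\varepsilon(t)=\mathbb E\exp(t^\top\varepsilon)<\infty$ for all $t\in\mathbb R^d$. Then $$\liminf_{n\to\infty}\frac{T_{n,\beta}^G}{n}\ \ge\ \int_{\mathbb R^d}\big(M_\varepsilon(t)-m(t)\big)^2w_\beta(t)\,\mathrm dt\quad\text{in probability},$$ that is, $\mathbb P(T_{n,\beta}^G/n\le c)\to0$ for every $c$ smaller than the right-hand side, which may be $+\infty$. Consequently, the test that rejects for large values of $T_{n,\beta}^G$ is consistent: if the law of $\varepsilon$ is not $\mathrm N_d(0,\mathrm I_d)$, then $\mathbb P(T_{n,\beta}^G\le c_n)\to0$ for every sequence $(c_n)$ of real critical values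 that is bounded above. -/

import Mathlib

open MeasureTheory ProbabilityTheory Filter Topology
open scoped ENNReal

noncomputable section

/-- `ℝ^d` with the Euclidean norm. -/
abbrev Vec (d : ℕ) := EuclideanSpace ℝ (Fin d)

/-! ### Matrices -/

section MatrixRoot
open scoped MatrixOrder

/-- The symmetric positive semidefinite square root `A^{1/2}` of a positive semidefinite matrix. -/
def matSqrt {d : ℕ} (A : Matrix (Fin d) (Fin d) ℝ) : Matrix (Fin d) (Fin d) ℝ := CFC.sqrt A

end MatrixRoot

/-- The `ℓ¹`-norm `∑ |a_{kj}|` of a matrix. -/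
def l1Norm {m n : ℕ} (A : Matrix (Fin m) (Fin n) ℝ) : ℝ := ∑ i, ∑ j, |A i j|

/-- The product of a matrix and a vector. -/
def matVec {m n : ℕ} (A : Matrix (Fin m) (Fin n) ℝ) (x : Vec n) : Vec m :=
  WithLp.toLp 2 (A.mulVec x.ofLp)

/-- The entrywise partial derivative `∂F/∂θ_k` of a matrix function on a set `Θ ⊆ ℝ^v`
(the ordinary partial derivative at interior points of `Θ`). -/
def matPartial {d v : ℕ} (Θ : Set (Vec v)) (k : Fin v)
    (F : Vec v → Matrix (Fin d) (Fin d) ℝ) (θ : Vec v) : Matrix (Fin d) (Fin d) ℝ :=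
  Matrix.of fun a b => fderivWithin ℝ (fun θ' => F θ' a b) Θ θ (EuclideanSpace.single k 1)

/-! ### The multivariate GARCH model

`S θ (x₁, x₂, …)` is the volatility function `Σ(θ; x₁, x₂, …)`; sequences `(x₁, x₂, …)` are indexed
by `ℕ` from `0`. -/

/-- The sequence `(x_{j-1}, x_{j-2}, …)`. -/
def past {d : ℕ} (x : ℤ → Vec d) (j : ℤ) : ℕ → Vec d := fun i => x (j - 1 - (i : ℤ))

/-- `Σ_j^{1/2}(θ) = Σ^{1/2}(θ; x_{j-1}, x_{j-2}, …)` along a path `x`. -/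
def volRoot {d v : ℕ} (S : Vec v → (ℕ → Vec d) → Matrix (Fin d) (Fin d) ℝ)
    (x : ℤ → Vec d) (j : ℤ) (θ : Vec v) : Matrix (Fin d) (Fin d) ℝ :=
  matSqrt (S θ (past x j))

/-- The path whose values at times `≤ 0` are replaced with the initial values `xinit`. -/
def initPath {d : ℕ} (xinit x : ℤ → Vec d) : ℤ → Vec d :=
  fun k => if 1 ≤ k then x k else xinit k

/-- The residual `Σ̃_j^{-1/2}(θ) x_j`, for `j ≥ 1`. -/
def garchResidual {d v : ℕ} (S : Vec v → (ℕ → Vec d) → Matrix (Fin d) (Fin d) ℝ)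
    (xinit x : ℤ → Vec d) (θ : Vec v) (j : ℕ) : Vec d :=
  matVec (volRoot S (initPath xinit x) j θ)⁻¹ (x j)

/-- The innovations `ε_j`, `j ∈ ℤ`, are i.i.d. with mean zero and unit covariance matrix. -/
structure IsInnovation {d : ℕ} {Ω : Type*} [MeasurableSpace Ω] (μ : Measure Ω)
    (eps : ℤ → Ω → Vec d) : Prop where
  measurable : ∀ j, Measurable (eps j)
  indep : iIndepFun eps μ
  identDistrib : ∀ j, IdentDistrib (eps j) (eps 0) μ μ
  memLp : MemLp (eps 0) 2 μ
  mean_zero : ∀ a, ∫ ω, eps 0 ω a ∂μ = 0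
  cov_one : ∀ a b, ∫ ω, eps 0 ω a * eps 0 ω b ∂μ = if a = b then 1 else 0

/-- `S` is a matrix-valued volatility function: for parameters in `Θ` it is measurable in the past
values and positive definite. -/
structure IsVolatility {d v : ℕ} (Θ : Set (Vec v))
    (S : Vec v → (ℕ → Vec d) → Matrix (Fin d) (Fin d) ℝ) : Prop where
  measurable : ∀ θ ∈ Θ, ∀ a b, Measurable fun x => S θ x a b
  posDef : ∀ θ ∈ Θ, ∀ x, (S θ x).PosDef

/-- `X` is a strictly stationary solution of `X_j = Σ_j^{1/2}(θ₀) ε_j`, `j ∈ ℤ`, with `X_j`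
measurable with respect to the `σ`-field generated by `ε_u`, `u ≤ j`. -/
structure IsStationaryGARCH {d v : ℕ} {Ω : Type*} [MeasurableSpace Ω] (μ : Measure Ω)
    (S : Vec v → (ℕ → Vec d) → Matrix (Fin d) (Fin d) ℝ) (θ₀ : Vec v)
    (eps X : ℤ → Ω → Vec d) : Prop where
  equation : ∀ j, ∀ᵐ ω ∂μ, X j ω = matVec (volRoot S (fun k => X k ω) j θ₀) (eps j ω)
  stationary : ∀ k : ℤ, μ.map (fun ω j => X (j + k) ω) = μ.map (fun ω j => X j ω)
  adapted : ∀ j,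
    Measurable[⨆ u : Set.Iic j, MeasurableSpace.comap (eps u) inferInstance] (X j)

/-! ### The assumptions (A.1)–(A.6) -/

/-- (A.1): asymptotic linearity of the estimator, with `L_j = h_j g_j`, `g_j = g(ε_j)`,
`h_j = h(ε_{j-1}, ε_{j-2}, …)`. -/
def AssumptionA1 {d v : ℕ} {Ω : Type*} [MeasurableSpace Ω] (μ : Measure Ω) (θ₀ : Vec v)
    (eps : ℤ → Ω → Vec d) (θhat : ℕ → Ω → Vec v) : Prop :=
  ∃ (g : Vec d → Vec (d ^ 2)) (h : (ℕ → Vec d) → Matrix (Fin v) (Fin (d ^ 2)) ℝ),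
    Measurable g ∧ (∀ a b, Measurable fun x => h x a b) ∧
    (∀ j a, ∫ ω, g (eps j ω) a ∂μ = 0) ∧
    (∀ j, Integrable (fun ω => ∑ a, g (eps j ω) a ^ 2) μ) ∧
    (∀ j, Integrable (fun ω => l1Norm (h (past (fun k => eps k ω) j) *
      (h (past (fun k => eps k ω) j)).transpose) ^ 2) μ) ∧
    TendstoInMeasure μ
      (fun (n : ℕ) ω => √(n : ℝ) • (θhat n ω - θ₀) -
        (√(n : ℝ))⁻¹ • ∑ j ∈ Finset.Icc 1 n,
          matVec (h (past (fun k => eps k ω) j)) (g (eps j ω)))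
      atTop (fun _ => 0)

/-- (A.2) -/
def AssumptionA2 {d v : ℕ} {Ω : Type*} [MeasurableSpace Ω] (μ : Measure Ω) (Θ : Set (Vec v))
    (S : Vec v → (ℕ → Vec d) → Matrix (Fin d) (Fin d) ℝ)
    (xinit : ℤ → Vec d) (X : ℤ → Ω → Vec d) : Prop :=
  ∃ C : ℝ, 0 < C ∧ ∀ᵐ ω ∂μ, ∀ j : ℕ, 1 ≤ j → ∀ θ ∈ Θ,
    l1Norm (volRoot S (initPath xinit fun k => X k ω) j θ)⁻¹ ≤ C ∧
    l1Norm (volRoot S (fun k => X k ω) j θ)⁻¹ ≤ C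

/-- (A.3); the constant `C` may depend on `ω`. -/
def AssumptionA3 {d v : ℕ} {Ω : Type*} [MeasurableSpace Ω] (μ : Measure Ω) (Θ : Set (Vec v))
    (S : Vec v → (ℕ → Vec d) → Matrix (Fin d) (Fin d) ℝ)
    (xinit : ℤ → Vec d) (X : ℤ → Ω → Vec d) : Prop :=
  ∃ ρ : ℝ, 0 < ρ ∧ ρ < 1 ∧ ∀ᵐ ω ∂μ, ∃ C : ℝ, 0 < C ∧ ∀ j : ℕ, 1 ≤ j → ∀ θ ∈ Θ,
    l1Norm (volRoot S (fun k => X k ω) j θ -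
      volRoot S (initPath xinit fun k => X k ω) j θ) ≤ C * ρ ^ j

/-- (A.4) -/
def AssumptionA4 {d v : ℕ} {Ω : Type*} [MeasurableSpace Ω] (μ : Measure Ω)
    (S : Vec v → (ℕ → Vec d) → Matrix (Fin d) (Fin d) ℝ) (θ₀ : Vec v)
    (X : ℤ → Ω → Vec d) : Prop :=
  ∃ s : ℝ, 0 < s ∧ ∀ j : ℤ,
    ∫⁻ ω, ENNReal.ofReal (‖X j ω‖ ^ s) ∂μ < ∞ ∧
    ∫⁻ ω, ENNReal.ofReal (l1Norm (volRoot S (fun k => X k ω) j θ₀) ^ s) ∂μ < ∞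

/-- (A.5) -/
def AssumptionA5 {d v : ℕ} (Θ : Set (Vec v))
    (S : Vec v → (ℕ → Vec d) → Matrix (Fin d) (Fin d) ℝ) : Prop :=
  ∀ x : ℕ → Vec d, ∀ a b, ContDiffOn ℝ 2 (fun θ => matSqrt (S θ x) a b) Θ

/-- (A.6), with suprema over the part of a neighbourhood `V` of `θ₀` that lies in `Θ`. -/
def AssumptionA6 {d v : ℕ} {Ω : Type*} [MeasurableSpace Ω] (μ : Measure Ω) (Θ : Set (Vec v))
    (S : Vec v → (ℕ → Vec d) → Matrix (Fin d) (Fin d) ℝ) (θ₀ : Vec v)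
    (X : ℤ → Ω → Vec d) : Prop :=
  ∃ V ∈ 𝓝 θ₀, ∃ p q r : ℝ, 1 < p ∧ 2 < q ∧ 1 < r ∧
    2 * p⁻¹ + 2 * r⁻¹ = 1 ∧ 4 * q⁻¹ + 2 * r⁻¹ = 1 ∧ ∀ j : ℤ,
    ∫⁻ ω, ⨆ θ ∈ V ∩ Θ, ENNReal.ofReal (l1Norm (∑ k, ∑ l,
      (volRoot S (fun u => X u ω) j θ)⁻¹ *
        matPartial Θ k (matPartial Θ l (volRoot S (fun u => X u ω) j)) θ) ^ p) ∂μ < ∞ ∧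
    ∫⁻ ω, ⨆ θ ∈ V ∩ Θ, ENNReal.ofReal (l1Norm (∑ k,
      (volRoot S (fun u => X u ω) j θ)⁻¹ *
        matPartial Θ k (volRoot S (fun u => X u ω) j) θ) ^ q) ∂μ < ∞ ∧
    ∫⁻ ω, ⨆ θ ∈ V ∩ Θ, ENNReal.ofReal (l1Norm (
      volRoot S (fun u => X u ω) j θ₀ * (volRoot S (fun u => X u ω) j θ)⁻¹) ^ r) ∂μ < ∞

/-! ### The test statistic -/

/-- The moment generating function `m(t) = exp(‖t‖²/2)` of the standard normal distribution. -/
def gaussMGF {d : ℕ} (t : Vec d) : ℝ := Real.exp (‖t‖ ^ 2 / 2)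

/-- The weight function `w_β(t) = exp(-β‖t‖²)`. -/
def weight {d : ℕ} (β : ℝ) (t : Vec d) : ℝ := Real.exp (-β * ‖t‖ ^ 2)

/-- The moment generating function `M_Y(t) = E exp(tᵀY)` of a random vector `Y`. -/
def vecMGF {d : ℕ} {Ω : Type*} [MeasurableSpace Ω] (μ : Measure Ω) (Y : Ω → Vec d)
    (t : Vec d) : ℝ :=
  ∫ ω, Real.exp (inner ℝ t (Y ω)) ∂μ

/-- The empirical moment generating function of `y_1, …, y_n`. -/
def empMGF {d : ℕ} (y : ℕ → Vec d) (n : ℕ) (t : Vec d) : ℝ :=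
  (n : ℝ)⁻¹ * ∑ j ∈ Finset.Icc 1 n, Real.exp (inner ℝ t (y j))

/-- `W_n(t) = √n (M_n(t) - m(t))`. -/
def empProcess {d : ℕ} (y : ℕ → Vec d) (n : ℕ) (t : Vec d) : ℝ :=
  √(n : ℝ) * (empMGF y n t - gaussMGF t)

/-- The statistic `∫ W_n(t)² w_β(t) dt` based on `y_1, …, y_n`. -/
def testStat {d : ℕ} (β : ℝ) (y : ℕ → Vec d) (n : ℕ) : ℝ≥0∞ :=
  ∫⁻ t : Vec d, ENNReal.ofReal (empProcess y n t ^ 2 * weight β t)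

/-- The statistic `T^G_{n,β}`, based on the residuals `Σ̃_j^{-1/2}(θ̂_n) X_j`, `1 ≤ j ≤ n`. -/
def garchStat {d v : ℕ} {Ω : Type*} (S : Vec v → (ℕ → Vec d) → Matrix (Fin d) (Fin d) ℝ)
    (xinit : ℤ → Vec d) (X : ℤ → Ω → Vec d) (θhat : ℕ → Ω → Vec v) (β : ℝ) (n : ℕ) (ω : Ω) :
    ℝ≥0∞ :=
  testStat β (garchResidual S xinit (fun k => X k ω) (θhat n ω)) n

/-- `∫ (M_ε(t) - m(t))² w_β(t) dt ∈ [0, ∞]`. -/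
def mgfDistance {d : ℕ} {Ω : Type*} [MeasurableSpace Ω] (μ : Measure Ω) (Y : Ω → Vec d)
    (β : ℝ) : ℝ≥0∞ :=
  ∫⁻ t : Vec d, ENNReal.ofReal ((vecMGF μ Y t - gaussMGF t) ^ 2 * weight β t)

/-- `liminf Y_n ≥ a` in probability: `P(Y_n ≤ c) → 0` for every `c < a`. -/
def LiminfGEInProb {Ω : Type*} [MeasurableSpace Ω] (μ : Measure Ω) (Y : ℕ → Ω → ℝ≥0∞)
    (a : ℝ≥0∞) : Prop :=
  ∀ c < a, Tendsto (fun n => μ {ω | Y n ω ≤ c}) atTop (𝓝 0)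

end

/-! Divided by `n`, the statistic is the squared `L²(w_β)`-distance between `m` and the empirical
moment generating function of the residuals. In probability, all but a vanishing fraction of the
residuals lie close to their innovations: the estimator is consistent, the volatility root is
continuous at `θ₀`, and the effect of the initial values decays geometrically. The remaining
residuals are not controlled and may contribute arbitrarily much, so only a lower bound can be
expected.

Split the empirical function into `A + R`, with `R ≥ 0` the contribution of the bad indices. Then
`A(t)` tends to `M_ε(t)`. Since `R` averages exponentials over a vanishing fraction of indices, a
bound on `R(t)` forces `R(c • t)` to be tiny for `c < 1` (`eventually_subMGF_smul_lt`). Along each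
ray `R` thus passes almost at once from nearly zero to huge, and the set where it takes intermediate
values has vanishing measure (`volume_shell_le`). Where `R` is small, the squared deviation is close
to `(M_ε - m)²`; where `R` is large, the deviation is large (`le_liminf_sq_of_tendsto_min_inv`).
Fatou's lemma gives the integrated bound.

`exists_pos_forall_lt_lintegral` turns this into a deterministic criterion whose conditions hold
with probability tending to one, by `tendsto_measure_card_residual` and
`IsInnovation.tendsto_measure_empMGF`. The test is consistent because a finite moment generating
function determines the law, so the limiting distance is positive off the null hypothesis. -/

section MatrixLemmas

/-! ### Matrix square roots, measurability and norms -/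

section
open scoped MatrixOrder

theorem matSqrt_posSemidef {d : ℕ} (A : Matrix (Fin d) (Fin d) ℝ) : (matSqrt A).PosSemidef :=
  Matrix.nonneg_iff_posSemidef.mp (CFC.sqrt_nonneg A)

theorem matSqrt_mul_matSqrt {d : ℕ} {A : Matrix (Fin d) (Fin d) ℝ} (hA : A.PosSemidef) :
    matSqrt A * matSqrt A = A :=
  CFC.sqrt_mul_sqrt_self A (Matrix.nonneg_iff_posSemidef.mpr hA)

theorem posSemidef_eq_of_mul_self_eq {d : ℕ} {A B : Matrix (Fin d) (Fin d) ℝ}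
    (hA : A.PosSemidef) (hB : B.PosSemidef) (h : A * A = B * B) : A = B := by
  rw [← CFC.sqrt_mul_self A (Matrix.nonneg_iff_posSemidef.mpr hA), h,
    CFC.sqrt_mul_self B (Matrix.nonneg_iff_posSemidef.mpr hB)]

end

theorem isUnit_det_matSqrt {d : ℕ} {A : Matrix (Fin d) (Fin d) ℝ} (hA : A.PosDef) :
    IsUnit (matSqrt A).det := by
  have h := congrArg Matrix.det (matSqrt_mul_matSqrt hA.posSemidef)
  rw [Matrix.det_mul] at h
  have := hA.det_pos
  rw [isUnit_iff_ne_zero]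
  rintro h0
  rw [h0] at h
  linarith

theorem isClosed_setOf_posSemidef (d : ℕ) :
    IsClosed {B : Fin d → Fin d → ℝ | (Matrix.of B).PosSemidef} := by
  have : {B : Fin d → Fin d → ℝ | (Matrix.of B).PosSemidef} =
      (⋂ a, ⋂ b, {B | B a b = B b a}) ∩
        ⋂ x : Fin d → ℝ, {B | 0 ≤ ∑ i, x i * ∑ j, B i j * x j} := by
    ext B
    simp only [Set.mem_ofPred_eq, Set.mem_inter_iff, Set.mem_iInter,
      Matrix.posSemidef_iff_dotProduct_mulVec]
    refine and_congr ?_ ?_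
    · rw [Matrix.IsHermitian.ext_iff]
      simp
      tauto
    · simp [dotProduct, Matrix.mulVec]
  rw [this]
  refine IsClosed.inter (isClosed_iInter fun a => isClosed_iInter fun b =>
    isClosed_eq (by fun_prop) (by fun_prop)) (isClosed_iInter fun x =>
    isClosed_le continuous_const (by fun_prop))

/-- Squaring is continuous and injective on the closed set of positive semidefinite matrices, hence
a measurable embedding there (Lusin–Souslin). The root is measurable because its square is. -/
theorem measurable_matSqrt_apply {d : ℕ} {α : Type*} [MeasurableSpace α]
    {A : α → Matrix (Fin d) (Fin d) ℝ} (hA : ∀ a b, Measurable fun x => A x a b)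
    (hpos : ∀ x, (A x).PosSemidef) (a b : Fin d) : Measurable fun x => matSqrt (A x) a b := by
  let s : Set (Fin d → Fin d → ℝ) := {B | (Matrix.of B).PosSemidef}
  let f : (Fin d → Fin d → ℝ) → Fin d → Fin d → ℝ := fun B i j => ∑ k, B i k * B k j
  have hemb : MeasurableEmbedding (s.domRestrict f) := by
    refine ContinuousOn.measurableEmbedding (isClosed_setOf_posSemidef d).measurableSet
      (Continuous.continuousOn (by fun_prop)) ?_
    intro B hB B' hB' h
    have : Matrix.of B * Matrix.of B = Matrix.of B' * Matrix.of B' := by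
      ext i j
      simpa [Matrix.mul_apply, f] using congrFun (congrFun h i) j
    exact Matrix.of.injective (posSemidef_eq_of_mul_self_eq hB hB' this)
  let r : α → s := fun x => ⟨fun i j => matSqrt (A x) i j, matSqrt_posSemidef (A x)⟩
  have hr : Measurable r := by
    rw [← hemb.measurable_comp_iff]
    have : s.domRestrict f ∘ r = fun x i j => A x i j := by
      funext x i j
      have h := congrFun (congrFun (matSqrt_mul_matSqrt (hpos x)) i) j
      rw [Matrix.mul_apply] at h
      exact h
    rw [this]
    exact measurable_pi_iff.mpr fun i => measurable_pi_iff.mpr fun j => hA i j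
  exact measurable_pi_iff.mp (measurable_pi_iff.mp (measurable_subtype_coe.comp hr) a) b

/-- Continuity in `θ` reduces the uncountable intersection to a countable dense subset of `Θ`. -/
theorem measurableSet_forall_le {v : ℕ} {α : Type*} [MeasurableSpace α] {Θ : Set (Vec v)}
    {F : Vec v → α → ℝ} (hcont : ∀ x, ContinuousOn (fun θ => F θ x) Θ)
    (hmeas : ∀ θ ∈ Θ, Measurable (F θ)) (c : ℝ) : MeasurableSet {x | ∀ θ ∈ Θ, F θ x ≤ c} := by
  obtain ⟨D, hDc, hD⟩ := TopologicalSpace.exists_countable_dense Θ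
  have : {x | ∀ θ ∈ Θ, F θ x ≤ c} = ⋂ θ ∈ D, {x | F (θ : Vec v) x ≤ c} := by
    ext x
    simp only [Set.mem_ofPred_eq, Set.mem_iInter]
    refine ⟨fun h θ _ => h θ θ.2, fun h θ hθ => ?_⟩
    have hc : Continuous fun θ : Θ => F θ x := continuousOn_iff_continuous_domRestrict.mp (hcont x)
    have hcl : IsClosed {θ : Θ | F θ x ≤ c} := isClosed_le hc continuous_const
    have : (⟨θ, hθ⟩ : Θ) ∈ {θ : Θ | F θ x ≤ c} :=
      hcl.closure_subset_iff.mpr (fun θ hθ => h θ hθ) (hD _)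
    exact this
  rw [this]
  exact MeasurableSet.biInter hDc fun θ _ => measurableSet_le (hmeas θ θ.2) measurable_const

theorem abs_apply_le_l1Norm {m n : ℕ} (A : Matrix (Fin m) (Fin n) ℝ) (i : Fin m) (j : Fin n) :
    |A i j| ≤ l1Norm A :=
  (Finset.single_le_sum (f := fun j => |A i j|) (fun _ _ => abs_nonneg _)
    (Finset.mem_univ j)).trans
  (Finset.single_le_sum (f := fun i => ∑ j, |A i j|)
    (fun _ _ => Finset.sum_nonneg fun _ _ => abs_nonneg _) (Finset.mem_univ i))

theorem l1Norm_add_le {m n : ℕ} (A B : Matrix (Fin m) (Fin n) ℝ) :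
    l1Norm (A + B) ≤ l1Norm A + l1Norm B := by
  simp only [l1Norm, ← Finset.sum_add_distrib]
  exact Finset.sum_le_sum fun i _ => Finset.sum_le_sum fun j _ => abs_add_le _ _

theorem norm_le_sum_abs {n : ℕ} (x : Vec n) : ‖x‖ ≤ ∑ i, |x i| := by
  conv_lhs => rw [← (EuclideanSpace.basisFun (Fin n) ℝ).sum_repr x]
  refine (norm_sum_le _ _).trans (Finset.sum_le_sum fun i _ => ?_)
  simp [norm_smul]

theorem norm_matVec_le {m n : ℕ} (A : Matrix (Fin m) (Fin n) ℝ) (x : Vec n) :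
    ‖matVec A x‖ ≤ l1Norm A * ‖x‖ := by
  refine (norm_le_sum_abs _).trans ?_
  rw [l1Norm, Finset.sum_mul]
  refine Finset.sum_le_sum fun i _ => ?_
  rw [Finset.sum_mul]
  refine (Finset.abs_sum_le_sum_abs (fun j => A i j * x j) Finset.univ).trans (Finset.sum_le_sum fun j _ => ?_)
  rw [abs_mul]
  exact mul_le_mul_of_nonneg_left (PiLp.norm_apply_le x j) (abs_nonneg _)

theorem matVec_inv_sub {d : ℕ} {A B : Matrix (Fin d) (Fin d) ℝ} (hB : IsUnit B.det) (x : Vec d) :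
    matVec B⁻¹ (matVec A x) - x = matVec B⁻¹ (matVec (A - B) x) := by
  ext i
  have : B⁻¹.mulVec ((A - B).mulVec x.ofLp) = B⁻¹.mulVec (A.mulVec x.ofLp) - x.ofLp := by
    rw [Matrix.sub_mulVec, Matrix.mulVec_sub, Matrix.mulVec_mulVec _ B⁻¹ B,
      Matrix.nonsing_inv_mul _ hB, Matrix.one_mulVec]
  simp [matVec, this]

end MatrixLemmas

/-! ### Moment generating functions and the characterisation of the normal law -/

section MGF

variable {d : ℕ} {Ω : Type*} [MeasurableSpace Ω] {μ : Measure Ω} {Y : Ω → Vec d}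

/-- A finite convex function on `ℝ^d` is continuous. -/
theorem continuous_vecMGF (hY : ∀ t : Vec d, Integrable (fun ω => Real.exp (inner ℝ t (Y ω))) μ) :
    Continuous (vecMGF μ Y) := by
  rw [← continuousOn_univ]
  refine ConvexOn.continuousOn isOpen_univ ⟨convex_univ, fun s _ t _ a b ha hb hab => ?_⟩
  simp only [vecMGF, smul_eq_mul]
  rw [← integral_const_mul, ← integral_const_mul,
    ← integral_add ((hY s).const_mul a) ((hY t).const_mul b)]
  refine integral_mono (hY _) (((hY s).const_mul a).add ((hY t).const_mul b)) fun ω => ?_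
  simpa [inner_add_left, real_inner_smul_left] using
    convexOn_exp.2 (Set.mem_univ (inner ℝ s (Y ω))) (Set.mem_univ (inner ℝ t (Y ω))) ha hb hab

theorem continuous_gaussMGF : Continuous (gaussMGF (d := d)) := by
  unfold gaussMGF; fun_prop

theorem continuous_weight (β : ℝ) : Continuous (weight (d := d) β) := by
  unfold weight; fun_prop

/-- Each projection `⟨t, Y⟩` has a Gaussian moment generating function on all of `ℝ`. Analytic
continuation to the imaginary unit yields the characteristic function. -/
theorem map_eq_stdGaussian_of_vecMGF_eq [IsProbabilityMeasure μ] (hYm : Measurable Y)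
    (hY : ∀ t : Vec d, Integrable (fun ω => Real.exp (inner ℝ t (Y ω))) μ)
    (h : ∀ t, vecMGF μ Y t = gaussMGF t) : μ.map Y = stdGaussian (Vec d) := by
  have := Measure.isProbabilityMeasure_map (μ := μ) hYm.aemeasurable
  refine Measure.ext_of_charFun (funext fun t => ?_)
  rw [charFun_stdGaussian, charFun_apply, integral_map hYm.aemeasurable
    (Measurable.aestronglyMeasurable (by fun_prop))]
  let Z : Ω → ℝ := fun ω => inner ℝ t (Y ω)
  have hmgf : mgf Z μ = mgf id (gaussianReal 0 (‖t‖₊ ^ 2)) := by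
    funext s
    rw [mgf_id_gaussianReal]
    have := h (s • t)
    simp only [vecMGF, gaussMGF, real_inner_smul_left, norm_smul, mul_pow, Real.norm_eq_abs,
      sq_abs] at this
    simp only [mgf, Z, this]
    congr 1
    push_cast
    ring
  have huniv : integrableExpSet Z μ = Set.univ := by
    refine Set.eq_univ_of_forall fun s => ?_
    simpa [integrableExpSet, Z, real_inner_smul_left] using hY (s • t)
  have hI := eqOn_complexMGF_of_mgf hmgf (x := Complex.I) (by simp [huniv])
  rw [complexMGF_id_gaussianReal] at hI
  simp only [complexMGF] at hI
  convert hI using 1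
  · refine integral_congr_ae (Eventually.of_forall fun ω => ?_)
    simp [Z, real_inner_comm, mul_comm]
  · congr 1
    simp

theorem map_eq_stdGaussian_of_mgfDistance_eq_zero [IsProbabilityMeasure μ] (hYm : Measurable Y)
    (hY : ∀ t : Vec d, Integrable (fun ω => Real.exp (inner ℝ t (Y ω))) μ) {β : ℝ}
    (h : mgfDistance μ Y β = 0) : μ.map Y = stdGaussian (Vec d) := by
  have hc := continuous_vecMGF hY
  have hg := continuous_gaussMGF (d := d)
  have hw := continuous_weight (d := d) β
  refine map_eq_stdGaussian_of_vecMGF_eq hYm hY (congrFun ?_)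
  refine Measure.eq_of_ae_eq (μ := volume) ?_ hc hg
  rw [mgfDistance, lintegral_eq_zero_iff (by fun_prop)] at h
  filter_upwards [h] with t ht
  have hpos : 0 < weight β t := Real.exp_pos _
  simp only [Pi.zero_apply, ENNReal.ofReal_eq_zero] at ht
  have : (vecMGF μ Y t - gaussMGF t) ^ 2 = 0 :=
    le_antisymm (nonpos_of_mul_nonpos_left ht hpos) (sq_nonneg _)
  exact sub_eq_zero.mp (pow_eq_zero_iff two_ne_zero |>.mp this)

end MGF

/-! ### Deterministic lower bound for perturbed empirical moment generating functions -/

noncomputable section EmpiricalMGF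

/-- The part of the empirical moment generating function of `y_1, …, y_n` that is due to the
indices in `s`. -/
def subMGF {d : ℕ} (y : ℕ → Vec d) (n : ℕ) (s : Finset ℕ) (t : Vec d) : ℝ :=
  (n : ℝ)⁻¹ * ∑ j ∈ s, Real.exp (inner ℝ t (y j))

/-- The finite measure `w_β(t) dt`. -/
def weightMeasure (d : ℕ) (β : ℝ) : Measure (Vec d) :=
  volume.withDensity fun t => ENNReal.ofReal (weight β t)

variable {d : ℕ}

theorem subMGF_nonneg (y : ℕ → Vec d) (n : ℕ) (s : Finset ℕ) (t : Vec d) : 0 ≤ subMGF y n s t := by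
  unfold subMGF; positivity

theorem continuous_subMGF (y : ℕ → Vec d) (n : ℕ) (s : Finset ℕ) : Continuous (subMGF y n s) := by
  unfold subMGF; fun_prop

theorem continuous_empMGF (y : ℕ → Vec d) (n : ℕ) : Continuous (empMGF y n) :=
  continuous_subMGF y n (Finset.Icc 1 n)

theorem subMGF_mono (y : ℕ → Vec d) (n : ℕ) {s s' : Finset ℕ} (h : s ⊆ s') (t : Vec d) :
    subMGF y n s t ≤ subMGF y n s' t := by
  unfold subMGF
  gcongr

theorem subMGF_filter_add (y : ℕ → Vec d) (n : ℕ) (p : ℕ → Prop) [DecidablePred p] (t : Vec d) :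
    subMGF y n ((Finset.Icc 1 n).filter p) t +
      subMGF y n ((Finset.Icc 1 n).filter fun j => ¬ p j) t = empMGF y n t := by
  unfold subMGF empMGF
  rw [← mul_add, Finset.sum_filter_add_sum_filter_not]

/-- Truncation at level `l`: the first term covers `z ≤ l`, the second `z ≥ l`. Summed over indices,
the first costs only their number, and the second has a factor that vanishes as `l → ∞` when `c <
1`. -/
theorem exp_mul_le {c : ℝ} (hc0 : 0 ≤ c) (hc1 : c ≤ 1) (l z : ℝ) :
    Real.exp (c * z) ≤ Real.exp (c * l) + Real.exp ((c - 1) * l) * Real.exp z := by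
  rcases le_total z l with h | h
  · have : Real.exp (c * z) ≤ Real.exp (c * l) := by gcongr
    have : 0 ≤ Real.exp ((c - 1) * l) * Real.exp z := by positivity
    linarith
  · have : Real.exp (c * z) ≤ Real.exp ((c - 1) * l) * Real.exp z := by
      rw [← Real.exp_add]
      gcongr
      nlinarith
    have : 0 ≤ Real.exp (c * l) := by positivity
    linarith

theorem subMGF_smul_le {c : ℝ} (hc0 : 0 ≤ c) (hc1 : c ≤ 1) (l : ℝ) (y : ℕ → Vec d) (n : ℕ)
    (s : Finset ℕ) (t : Vec d) :
    subMGF y n s (c • t) ≤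
      Real.exp (c * l) * (s.card / n) + Real.exp ((c - 1) * l) * subMGF y n s t := by
  have : ∑ j ∈ s, Real.exp (inner ℝ (c • t) (y j)) ≤
      s.card * Real.exp (c * l) +
        Real.exp ((c - 1) * l) * ∑ j ∈ s, Real.exp (inner ℝ t (y j)) := by
    rw [Finset.mul_sum, ← nsmul_eq_mul, ← Finset.sum_const, ← Finset.sum_add_distrib]
    refine Finset.sum_le_sum fun j _ => ?_
    rw [real_inner_smul_left]
    exact exp_mul_le hc0 hc1 l _
  unfold subMGF
  calc _ ≤ (n : ℝ)⁻¹ * (s.card * Real.exp (c * l) +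
        Real.exp ((c - 1) * l) * ∑ j ∈ s, Real.exp (inner ℝ t (y j))) := by gcongr
    _ = _ := by ring

theorem tendsto_exp_sub_one_mul {c : ℝ} (hc1 : c < 1) :
    Tendsto (fun l => Real.exp ((c - 1) * l)) atTop (𝓝 0) :=
  Real.tendsto_exp_atBot.comp (tendsto_id.const_mul_atTop_of_neg (by linarith))

/-- Along rays, empirical moment generating functions of vanishing mass that stay bounded at `t`
become uniformly small at `c • t`. -/
theorem eventually_subMGF_smul_lt {y : ℕ → ℕ → Vec d} {n : ℕ → ℕ} {s : ℕ → Finset ℕ}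
    (hs : Tendsto (fun k => ((s k).card : ℝ) / n k) atTop (𝓝 0)) {a b c : ℝ} (ha : 0 < a)
    (hc0 : 0 ≤ c) (hc1 : c < 1) :
    ∀ᶠ k in atTop, ∀ t, subMGF (y k) (n k) (s k) t ≤ b →
      subMGF (y k) (n k) (s k) (c • t) < a := by
  have h1 : Tendsto (fun l => Real.exp ((c - 1) * l) * b) atTop (𝓝 0) := by
    simpa using (tendsto_exp_sub_one_mul hc1).mul_const b
  obtain ⟨l, hl⟩ := (h1.eventually (gt_mem_nhds (half_pos ha))).exists
  have h2 : Tendsto (fun k => Real.exp (c * l) * (((s k).card : ℝ) / n k)) atTop (𝓝 0) := by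
    simpa using hs.const_mul (Real.exp (c * l))
  filter_upwards [h2.eventually (gt_mem_nhds (half_pos ha))] with k hk t ht
  have := subMGF_smul_le hc0 hc1.le l (y k) (n k) (s k) t
  have : Real.exp ((c - 1) * l) * subMGF (y k) (n k) (s k) t ≤ Real.exp ((c - 1) * l) * b := by
    gcongr
  linarith

open scoped Pointwise in
-- Let `C` be the part of the ball where `f ≤ b`. Shrinking by `c` sends `C` into `{f < a}`, so the
-- shell lies in `C \ c • C`, and scaling multiplies volume by `c ^ d`.
theorem volume_shell_le {f : Vec d → ℝ} (hf : Continuous f) {a b c : ℝ} (hc0 : 0 < c)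
    (hc1 : c ≤ 1) (h : ∀ t, f t ≤ b → f (c • t) < a) (K : ℝ) :
    volume (Metric.closedBall 0 K ∩ {t | a ≤ f t ∧ f t ≤ b}) ≤
      ENNReal.ofReal (1 - c ^ d) * volume (Metric.closedBall (0 : Vec d) K) := by
  rcases lt_or_ge b a with hab | hab
  · have : Metric.closedBall 0 K ∩ {t | a ≤ f t ∧ f t ≤ b} = ∅ := by
      ext t
      simp only [Set.mem_inter_iff, Set.mem_ofPred_eq, Set.mem_empty_iff_false, iff_false]
      rintro ⟨_, h1, h2⟩
      linarith
    simp [this]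
  set C : Set (Vec d) := Metric.closedBall 0 K ∩ {t | f t ≤ b} with hC
  have hCm : MeasurableSet C :=
    measurableSet_closedBall.inter (measurableSet_le hf.measurable measurable_const)
  have hCb : volume C ≤ volume (Metric.closedBall (0 : Vec d) K) :=
    measure_mono Set.inter_subset_left
  have hCfin : volume C ≠ ∞ := (hCb.trans_lt measure_closedBall_lt_top).ne
  have hsub : c • C ⊆ C := by
    rintro _ ⟨t, ht, rfl⟩
    refine ⟨?_, ((h t ht.2).le.trans hab)⟩
    have := ht.1
    simp only [mem_closedBall_zero_iff, norm_smul, Real.norm_eq_abs, abs_of_pos hc0] at this ⊢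
    nlinarith [norm_nonneg t]
  have hscale : volume (c • C) = ENNReal.ofReal (c ^ d) * volume C := by
    rw [Measure.addHaar_smul, finrank_euclideanSpace_fin, abs_of_nonneg (by positivity)]
  calc volume (Metric.closedBall 0 K ∩ {t | a ≤ f t ∧ f t ≤ b})
      ≤ volume (C \ c • C) := by
        refine measure_mono ?_
        rintro t ⟨htK, hta, htb⟩
        refine ⟨⟨htK, htb⟩, ?_⟩
        rintro ⟨u, hu, rfl⟩
        exact absurd (h u hu.2) (not_lt.mpr hta)
    _ = volume C - volume (c • C) :=
        measure_sdiff hsub (hCm.const_smul_of_ne_zero hc0.ne').nullMeasurableSet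
          (measure_ne_top_of_subset hsub hCfin)
    _ = ENNReal.ofReal (1 - c ^ d) * volume C := by
        rw [hscale, ENNReal.ofReal_sub _ (by positivity), ENNReal.sub_mul (fun _ _ => hCfin)]
        simp
    _ ≤ _ := by gcongr

theorem isFiniteMeasure_weightMeasure {β : ℝ} (hβ : 0 < β) :
    IsFiniteMeasure (weightMeasure d β) := by
  refine isFiniteMeasure_withDensity_ofReal (Integrable.hasFiniteIntegral ?_)
  have h := GaussianFourier.integrable_cexp_neg_mul_sq_norm_add (V := Vec d) (b := (β : ℂ))
    (by simpa using hβ) 0 0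
  refine h.norm.congr (Eventually.of_forall fun t => ?_)
  simp only [weight, Complex.norm_exp]
  congr 1
  simp [← Complex.ofReal_pow]

theorem weightMeasure_le {β : ℝ} (hβ : 0 < β) (s : Set (Vec d)) :
    weightMeasure d β s ≤ volume s := by
  have : weightMeasure d β ≤ volume := by
    conv_rhs => rw [← withDensity_one (μ := (volume : Measure (Vec d)))]
    refine withDensity_mono (Eventually.of_forall fun t => ?_)
    simp only [weight, Pi.one_apply, ENNReal.ofReal_le_one, Real.exp_le_one_iff]
    nlinarith [sq_nonneg ‖t‖]
  exact this s

theorem lintegral_weightMeasure {β : ℝ} {f : Vec d → ℝ} (hf : Continuous f) :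
    ∫⁻ t, ENNReal.ofReal (f t ^ 2) ∂(weightMeasure d β) =
      ∫⁻ t, ENNReal.ofReal (f t ^ 2 * weight β t) := by
  have hw := continuous_weight (d := d) β
  rw [weightMeasure, lintegral_withDensity_eq_lintegral_mul _ (by fun_prop) (by fun_prop)]
  refine lintegral_congr fun t => ?_
  rw [Pi.mul_apply, mul_comm, ← ENNReal.ofReal_mul (sq_nonneg _)]

/-- Outside a large ball the finite weight measure is small. Inside, it is dominated by Lebesgue
measure and `volume_shell_le` applies with `c` close to `1`. -/
theorem tendsto_weightMeasure_shell {β : ℝ} (hβ : 0 < β) {y : ℕ → ℕ → Vec d} {n : ℕ → ℕ}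
    {s : ℕ → Finset ℕ} (hs : Tendsto (fun k => ((s k).card : ℝ) / n k) atTop (𝓝 0)) {a b : ℝ}
    (ha : 0 < a) :
    Tendsto (fun k => weightMeasure d β {t | a ≤ subMGF (y k) (n k) (s k) t ∧
      subMGF (y k) (n k) (s k) t ≤ b}) atTop (𝓝 0) := by
  have := isFiniteMeasure_weightMeasure (d := d) hβ
  rw [ENNReal.tendsto_nhds_zero]
  intro ξ hξ
  have hξ2 : 0 < ξ / 2 := ENNReal.half_pos hξ.ne'
  have hK : Tendsto (fun K : ℕ => weightMeasure d β (Metric.closedBall (0 : Vec d) K)ᶜ) atTop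
      (𝓝 0) := by
    have h := tendsto_measure_iInter_atTop (μ := weightMeasure d β)
      (s := fun K : ℕ => (Metric.closedBall (0 : Vec d) K)ᶜ)
      (fun K => measurableSet_closedBall.compl.nullMeasurableSet)
      (fun K K' hKK' => Set.compl_subset_compl.mpr
        (Metric.closedBall_subset_closedBall (by exact_mod_cast hKK')))
      ⟨0, measure_ne_top _ _⟩
    rw [← Set.compl_iUnion, Metric.iUnion_closedBall_nat] at h
    simpa [Function.comp_def] using h
  obtain ⟨K, hKξ⟩ := (hK.eventually (gt_mem_nhds hξ2)).exists
  have hcξ : Tendsto (fun c : ℝ => ENNReal.ofReal (1 - c ^ d) *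
      volume (Metric.closedBall (0 : Vec d) K)) (𝓝[<] 1) (𝓝 0) := by
    have h0 : Tendsto (fun c : ℝ => ENNReal.ofReal (1 - c ^ d)) (𝓝[<] 1) (𝓝 0) := by
      have : Continuous fun c : ℝ => ENNReal.ofReal (1 - c ^ d) :=
        ENNReal.continuous_ofReal.comp (by fun_prop)
      simpa using (this.tendsto 1).mono_left nhdsWithin_le_nhds
    simpa using ENNReal.Tendsto.mul_const h0 (Or.inr measure_closedBall_lt_top.ne)
  have hIoo : ∀ᶠ c : ℝ in 𝓝[<] 1, c ∈ Set.Ioo (0 : ℝ) 1 := Ioo_mem_nhdsLT one_pos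
  obtain ⟨c, hc, hc0, hc1⟩ := ((hcξ.eventually (gt_mem_nhds hξ2)).and hIoo).exists
  filter_upwards [eventually_subMGF_smul_lt (y := y) (b := b) hs ha hc0.le hc1] with k hk
  set A := {t | a ≤ subMGF (y k) (n k) (s k) t ∧ subMGF (y k) (n k) (s k) t ≤ b}
  calc weightMeasure d β A
      ≤ weightMeasure d β (Metric.closedBall 0 K ∩ A ∪ (Metric.closedBall 0 K)ᶜ) := by
        refine measure_mono fun t ht => ?_
        by_cases h : t ∈ Metric.closedBall (0 : Vec d) K
        · exact Or.inl ⟨h, ht⟩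
        · exact Or.inr h
    _ ≤ weightMeasure d β (Metric.closedBall 0 K ∩ A) +
        weightMeasure d β (Metric.closedBall 0 K)ᶜ := measure_union_le _ _
    _ ≤ ξ / 2 + ξ / 2 := by
        gcongr
        exact (weightMeasure_le hβ _).trans
          ((volume_shell_le (continuous_subMGF _ _ _) hc0 hc1.le hk K).trans hc.le)
    _ = ξ := ENNReal.add_halves ξ

/-- Smallness of `min R R⁻¹` encodes "near zero or near infinity": `min R R⁻¹ ≥ a` places `R` in the
shell `[a, a⁻¹]`. -/
theorem tendstoInMeasure_min_subMGF_inv {β : ℝ} (hβ : 0 < β) {y : ℕ → ℕ → Vec d} {n : ℕ → ℕ}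
    {s : ℕ → Finset ℕ} (hs : Tendsto (fun k => ((s k).card : ℝ) / n k) atTop (𝓝 0)) :
    TendstoInMeasure (weightMeasure d β) (fun k t => min (subMGF (y k) (n k) (s k) t)
      (subMGF (y k) (n k) (s k) t)⁻¹) atTop 0 := by
  rw [tendstoInMeasure_iff_norm]
  intro a ha
  refine tendsto_of_tendsto_of_tendsto_of_le_of_le tendsto_const_nhds
    (tendsto_weightMeasure_shell (y := y) (b := a⁻¹) hβ hs ha) (fun _ => zero_le) fun k => ?_
  refine measure_mono fun t ht => ?_
  have h0 := subMGF_nonneg (y k) (n k) (s k) t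
  simp only [Pi.zero_apply, sub_zero, Real.norm_eq_abs, Set.mem_ofPred_eq] at ht ⊢
  rw [abs_of_nonneg (le_min h0 (inv_nonneg.mpr h0)), le_min_iff] at ht
  exact ⟨ht.1, (le_inv_comm₀ ha (ha.trans_le ht.1)).mp ht.2⟩

/-- Small perturbations of most observations hardly change the empirical moment generating
function, apart from the contribution of the other observations. -/
theorem tendsto_subMGF_filter {y e : ℕ → ℕ → Vec d} {n : ℕ → ℕ} {η : ℕ → ℝ}
    (hη : Tendsto η atTop (𝓝 0))
    (hs : Tendsto (fun k => (((Finset.Icc 1 (n k)).filter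
      fun j => ¬ ‖y k j - e k j‖ ≤ η k).card : ℝ) / n k) atTop (𝓝 0))
    {t : Vec d} {M M' : ℝ} (hM : Tendsto (fun k => empMGF (e k) (n k) t) atTop (𝓝 M))
    (hM' : Tendsto (fun k => empMGF (e k) (n k) ((2 : ℝ) • t)) atTop (𝓝 M')) :
    Tendsto (fun k => subMGF (y k) (n k) ((Finset.Icc 1 (n k)).filter
      fun j => ‖y k j - e k j‖ ≤ η k) t) atTop (𝓝 M) := by
  set J : ℕ → Finset ℕ := fun k => (Finset.Icc 1 (n k)).filter fun j => ‖y k j - e k j‖ ≤ η k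
  set B : ℕ → Finset ℕ := fun k => (Finset.Icc 1 (n k)).filter fun j => ¬ ‖y k j - e k j‖ ≤ η k
  have hB : Tendsto (fun k => subMGF (e k) (n k) (B k) t) atTop (𝓝 0) := by
    rw [Metric.tendsto_nhds]
    intro a ha
    -- The ray estimate is applied from `2 • t` down to `t`; this is why convergence at `2 • t` is
    -- assumed.
    filter_upwards [eventually_subMGF_smul_lt (y := e) (b := M' + 1) (c := 1 / 2) hs ha
      (by norm_num) (by norm_num), hM'.eventually (gt_mem_nhds (lt_add_one M'))] with k hk hk'
    have := hk ((2 : ℝ) • t) ((subMGF_mono (e k) (n k) (Finset.filter_subset _ _) _).trans hk'.le)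
    rw [smul_smul, show (1 / 2 : ℝ) * 2 = 1 by norm_num, one_smul] at this
    rwa [Real.dist_eq, sub_zero, abs_of_nonneg (subMGF_nonneg _ _ _ _)]
  have hJ : Tendsto (fun k => subMGF (e k) (n k) (J k) t) atTop (𝓝 M) := by
    have := hM.sub hB
    rw [sub_zero] at this
    refine this.congr fun k => ?_
    rw [← subMGF_filter_add (e k) (n k) (fun j => ‖y k j - e k j‖ ≤ η k) t]
    exact add_sub_cancel_right _ _
  have hbound : ∀ k, ∀ j ∈ J k, |inner ℝ t (y k j) - inner ℝ t (e k j)| ≤ ‖t‖ * η k := by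
    intro k j hj
    rw [← inner_sub_right]
    exact (abs_real_inner_le_norm _ _).trans
      (mul_le_mul_of_nonneg_left (Finset.mem_filter.mp hj).2 (norm_nonneg _))
  have hexp : Tendsto (fun k => Real.exp (‖t‖ * η k)) atTop (𝓝 1) := by
    have := (Real.continuous_exp.tendsto _).comp (hη.const_mul ‖t‖)
    simpa [Function.comp_def] using this
  have hexp' : Tendsto (fun k => Real.exp (-(‖t‖ * η k))) atTop (𝓝 1) := by
    have := (Real.continuous_exp.tendsto _).comp (hη.const_mul ‖t‖).neg
    simpa [Function.comp_def] using this
  have hl := hexp'.mul hJ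
  have hu := hexp.mul hJ
  rw [one_mul] at hl hu
  refine tendsto_of_tendsto_of_tendsto_of_le_of_le hl hu (fun k => ?_) fun k => ?_
  · simp only [subMGF]
    rw [mul_left_comm, Finset.mul_sum]
    gcongr with j hj
    rw [← Real.exp_add]
    gcongr
    linarith [(abs_le.mp (hbound k j hj)).1]
  · simp only [subMGF]
    rw [mul_left_comm, Finset.mul_sum _ _ (Real.exp (‖t‖ * η k))]
    gcongr with j hj
    rw [← Real.exp_add]
    gcongr
    linarith [(abs_le.mp (hbound k j hj)).2]

theorem le_liminf_sq_of_tendsto_min_inv {A R : ℕ → ℝ} {M m : ℝ} (hA : Tendsto A atTop (𝓝 M))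
    (hR0 : ∀ k, 0 ≤ R k) (hR : Tendsto (fun k => min (R k) (R k)⁻¹) atTop (𝓝 0)) :
    ENNReal.ofReal ((M - m) ^ 2) ≤
      liminf (fun k => ENNReal.ofReal ((A k + R k - m) ^ 2)) atTop := by
  refine le_of_forall_lt fun b hb => ?_
  obtain ⟨b', hbb', hb'⟩ := exists_between hb
  refine hbb'.trans_le (le_liminf_of_le (by isBoundedDefault) ?_)
  have hbtop : b' ≠ ∞ := (hb'.trans_le le_top).ne
  lift b' to NNReal using hbtop
  have hpos : (b' : ℝ) < (M - m) ^ 2 := by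
    have := hb'
    rwa [ENNReal.ofReal, ENNReal.coe_lt_coe, Real.lt_toNNReal_iff_coe_lt] at this
  have hcont : Continuous fun p : ℝ × ℝ => (p.1 + p.2 - m) ^ 2 := by fun_prop
  have hev : ∀ᶠ p : ℝ × ℝ in 𝓝 (M, 0), (b' : ℝ) < (p.1 + p.2 - m) ^ 2 :=
    (hcont.tendsto (M, 0)).eventually (lt_mem_nhds (by simpa using hpos))
  rw [Metric.eventually_nhds_iff] at hev
  obtain ⟨δ, hδ, hball⟩ := hev
  -- If `A ≥ M - 1` and `R > L`, then `A + R - m ≥ b' + 1`, whose square exceeds `b'`.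
  set L : ℝ := |m| + |M| + 1 + (b' + 1) with hL
  have hLpos : 0 < L := by positivity
  filter_upwards [Metric.tendsto_nhds.mp hA δ hδ, Metric.tendsto_nhds.mp hA 1 one_pos,
    hR.eventually (gt_mem_nhds (lt_min hδ (inv_pos.mpr hLpos)))] with k h1 h2 h3
  rw [ENNReal.ofReal, ENNReal.coe_le_coe, ← NNReal.coe_le_coe, Real.coe_toNNReal _ (sq_nonneg _)]
  rcases min_lt_iff.mp h3 with h | h
  · refine (hball (y := (A k, R k)) ?_).le
    rw [Prod.dist_eq, max_lt_iff]
    refine ⟨h1, ?_⟩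
    rw [Real.dist_eq, sub_zero, abs_of_nonneg (hR0 k)]
    exact h.trans_le (min_le_left _ _)
  -- `R k = 0` has to be set apart: there `(R k)⁻¹ = 0` by convention, and a small inverse does not
  -- mean that `R k` is large.
  · rcases (hR0 k).eq_or_lt with h0 | h0
    · refine (hball (y := (A k, R k)) ?_).le
      rw [Prod.dist_eq, max_lt_iff]
      refine ⟨h1, ?_⟩
      simpa [← h0] using hδ
    · have hRL : L < R k := by
        have := h.trans_le (min_le_right _ _)
        exact (inv_lt_inv₀ h0 hLpos).mp this
      rw [Real.dist_eq] at h2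
      have h4 := (abs_lt.mp h2).1
      have h5 := neg_abs_le M
      have h6 := le_abs_self m
      have h7 : (b' : ℝ) + 1 ≤ A k + R k - m := by linarith
      nlinarith [b'.coe_nonneg]

theorem exists_subseq_lintegral_le {β : ℝ} (hβ : 0 < β) {y e : ℕ → ℕ → Vec d} {n : ℕ → ℕ}
    {η : ℕ → ℝ} {M : Vec d → ℝ} (hη : Tendsto η atTop (𝓝 0))
    (hs : Tendsto (fun k => (((Finset.Icc 1 (n k)).filter
      fun j => ¬ ‖y k j - e k j‖ ≤ η k).card : ℝ) / n k) atTop (𝓝 0))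
    (hM : TendstoInMeasure (weightMeasure d β) (fun k => empMGF (e k) (n k)) atTop M)
    (hM' : TendstoInMeasure (weightMeasure d β) (fun k t => empMGF (e k) (n k) ((2 : ℝ) • t)) atTop
      fun t => M ((2 : ℝ) • t)) :
    ∃ ns : ℕ → ℕ, StrictMono ns ∧
      ∫⁻ t, ENNReal.ofReal ((M t - gaussMGF t) ^ 2) ∂(weightMeasure d β) ≤
        liminf (fun k => ∫⁻ t, ENNReal.ofReal ((empMGF (y (ns k)) (n (ns k)) t - gaussMGF t) ^ 2)
          ∂(weightMeasure d β)) atTop := by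
  -- Three nested subsequences turn the convergences in measure at `t`, at `2 • t` and of `min R
  -- R⁻¹` into almost everywhere convergence; Fatou's lemma then applies.
  obtain ⟨n₁, hn₁, h₁⟩ := hM.exists_seq_tendsto_ae
  obtain ⟨n₂, hn₂, h₂⟩ := (hM'.comp hn₁.tendsto_atTop).exists_seq_tendsto_ae
  have hR := tendstoInMeasure_min_subMGF_inv (y := y) hβ hs
  obtain ⟨n₃, hn₃, h₃⟩ :=
    (hR.comp (hn₁.tendsto_atTop.comp hn₂.tendsto_atTop)).exists_seq_tendsto_ae
  refine ⟨n₁ ∘ n₂ ∘ n₃, hn₁.comp (hn₂.comp hn₃), ?_⟩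
  have hg := continuous_gaussMGF (d := d)
  have hns := hn₁.tendsto_atTop.comp (hn₂.tendsto_atTop.comp hn₃.tendsto_atTop)
  refine le_trans (lintegral_mono_ae ?_) (lintegral_liminf_le fun k => ?_)
  · filter_upwards [h₁, h₂, h₃] with t ht₁ ht₂ ht₃
    have hA := tendsto_subMGF_filter (y := fun k => y (n₁ (n₂ (n₃ k))))
      (e := fun k => e (n₁ (n₂ (n₃ k)))) (n := fun k => n (n₁ (n₂ (n₃ k)))) (hη.comp hns)
      (hs.comp hns) (ht₁.comp (hn₂.tendsto_atTop.comp hn₃.tendsto_atTop))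
      (ht₂.comp hn₃.tendsto_atTop)
    refine (le_liminf_sq_of_tendsto_min_inv (m := gaussMGF t) hA
      (fun k => subMGF_nonneg _ _ _ _) ht₃).trans (le_of_eq ?_)
    congr 1
    funext k
    simp only [Function.comp_apply]
    rw [← subMGF_filter_add _ _ (fun j => ‖y (n₁ (n₂ (n₃ k))) j - e (n₁ (n₂ (n₃ k))) j‖ ≤
      η (n₁ (n₂ (n₃ k)))) t]
  · have := continuous_empMGF (y ((n₁ ∘ n₂ ∘ n₃) k)) (n ((n₁ ∘ n₂ ∘ n₃) k))
    fun_prop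

/-- The weighted `L²`-distance of an empirical moment generating function from the normal one
exceeds a given number below the limit distance as soon as most observations are close to
observations whose empirical moment generating function is close to `M`. -/
theorem exists_pos_forall_lt_lintegral {β : ℝ} (hβ : 0 < β) (M : Vec d → ℝ) {c : ℝ≥0∞}
    (hc : c < ∫⁻ t, ENNReal.ofReal ((M t - gaussMGF t) ^ 2) ∂(weightMeasure d β)) :
    ∃ γ : ℝ, 0 < γ ∧ ∀ (n : ℕ) (y e : ℕ → Vec d),
      (((Finset.Icc 1 n).filter fun j => ¬ ‖y j - e j‖ ≤ γ).card : ℝ) / n ≤ γ →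
      weightMeasure d β {t | γ ≤ ‖empMGF e n t - M t‖} ≤ ENNReal.ofReal γ →
      weightMeasure d β {t | γ ≤ ‖empMGF e n ((2 : ℝ) • t) - M ((2 : ℝ) • t)‖} ≤
        ENNReal.ofReal γ →
      c < ∫⁻ t, ENNReal.ofReal ((empMGF y n t - gaussMGF t) ^ 2) ∂(weightMeasure d β) := by
  by_contra hcon
  simp only [not_exists, not_and, not_forall, exists_prop, not_lt] at hcon
  have hpos : ∀ k : ℕ, (0 : ℝ) < 1 / ((k : ℝ) + 1) := fun k => Nat.one_div_pos_of_nat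
  -- Counterexamples for `γ = 1 / (k + 1)` form a sequence satisfying the hypotheses of
  -- `exists_subseq_lintegral_le`, while all its integrals stay at most `c`.
  choose n y e h1 h2 h3 h4 using fun k : ℕ => hcon _ (hpos k)
  have hη : Tendsto (fun k : ℕ => 1 / ((k : ℝ) + 1)) atTop (𝓝 0) :=
    tendsto_one_div_add_atTop_nhds_zero_nat
  have hη' : Tendsto (fun k : ℕ => ENNReal.ofReal (1 / ((k : ℝ) + 1))) atTop (𝓝 0) := by
    simpa using ENNReal.tendsto_ofReal hη
  have hmeas : ∀ f : ℕ → Vec d → ℝ, (∀ k : ℕ, weightMeasure d β {t | 1 / ((k : ℝ) + 1) ≤ ‖f k t‖} ≤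
      ENNReal.ofReal (1 / ((k : ℝ) + 1))) → ∀ a > 0,
      Tendsto (fun k => weightMeasure d β {t | a ≤ ‖f k t‖}) atTop (𝓝 0) := by
    intro f hf a ha
    refine tendsto_of_tendsto_of_tendsto_of_le_of_le' tendsto_const_nhds hη'
      (Eventually.of_forall fun _ => zero_le) ?_
    filter_upwards [hη.eventually (gt_mem_nhds ha)] with k hk
    exact (measure_mono fun t ht => hk.le.trans ht).trans (hf k)
  obtain ⟨ns, hns, hle⟩ := exists_subseq_lintegral_le (y := y) (e := e) (n := n) (M := M) hβ hη
    (squeeze_zero (fun k => by positivity) h1 hη)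
    (tendstoInMeasure_iff_norm.mpr (hmeas _ h2)) (tendstoInMeasure_iff_norm.mpr (hmeas _ h3))
  refine absurd (hle.trans ?_) (not_le.mpr hc)
  exact (liminf_le_liminf (Eventually.of_forall fun k => h4 (ns k))).trans (by simp)

end EmpiricalMGF

/-! ### Consistency of the estimator -/

section Consistency

variable {d : ℕ} {Ω : Type*} {eps : ℤ → Ω → Vec d}

theorem measurable_past {X : ℤ → Ω → Vec d} {m : MeasurableSpace Ω} {j : ℤ}
    (hX : ∀ k < j, Measurable[m] (X k)) : Measurable[m] fun ω => past (fun k => X k ω) j :=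
  measurable_pi_iff.mpr fun i => hX _ (by omega)

/-- The `σ`-field generated by the innovations before time `j`. -/
abbrev pastField (eps : ℤ → Ω → Vec d) (j : ℤ) : MeasurableSpace Ω :=
  ⨆ u ∈ Set.Iio j, MeasurableSpace.comap (eps u) inferInstance

theorem measurable_pastField {j k : ℤ} (hk : k < j) : Measurable[pastField eps j] (eps k) :=
  (comap_measurable (eps k)).mono
    (le_iSup₂_of_le (f := fun u (_ : u ∈ Set.Iio j) => MeasurableSpace.comap (eps u) inferInstance)
      k hk le_rfl) le_rfl

variable [MeasurableSpace Ω] {μ : Measure Ω}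

namespace IsInnovation

theorem indepFun_of_measurable_pastField (hε : IsInnovation μ eps) {j : ℤ} {Z : Ω → ℝ}
    (hZ : Measurable[pastField eps j] Z) {G : Vec d → ℝ} (hG : Measurable G) :
    IndepFun Z (fun ω => G (eps j ω)) μ := by
  have h := indep_iSup_of_disjoint (fun u => (hε.measurable u).comap_le) hε.indep.iIndep
    (S := Set.Iio j) (T := {j}) (by simp)
  have hj : ⨆ u ∈ ({j} : Set ℤ), MeasurableSpace.comap (eps u) inferInstance =
      MeasurableSpace.comap (eps j) inferInstance := by simp
  rw [hj] at h
  rw [IndepFun_iff_Indep]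
  exact indep_of_indep_of_le_left (indep_of_indep_of_le_right h
    (hG.comp (comap_measurable (eps j))).comap_le) hZ.comap_le

/-- The right-hand side is free of `j`, so moments of functions of the past do not depend on time.
-/
theorem map_past_eq (hε : IsInnovation μ eps) (j : ℤ) :
    μ.map (fun ω => past (fun k => eps k ω) j) = Measure.infinitePi fun _ => μ.map (eps 0) := by
  have hinj : Function.Injective fun i : ℕ => j - 1 - (i : ℤ) := fun a b h => by
    simp only at h; omega
  have h := (hε.indep.precomp hinj).map_fun_eq_infinitePi_map fun i => hε.measurable _
  simp only [(hε.identDistrib _).map_eq] at h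
  exact h

variable {H : (ℕ → Vec d) → ℝ} {G : Vec d → ℝ}

theorem integral_past_eq [IsProbabilityMeasure μ] (hε : IsInnovation μ eps) (hH : Measurable H) (j : ℤ) :
    ∫ ω, H (past (fun k => eps k ω) j) ∂μ = ∫ ω, H (past (fun k => eps k ω) 0) ∂μ := by
  have hm : ∀ j, Measurable fun ω => past (fun k => eps k ω) j :=
    fun j => measurable_past fun k _ => hε.measurable k
  rw [← integral_map (hm j).aemeasurable hH.aestronglyMeasurable, hε.map_past_eq j,
    ← hε.map_past_eq 0, integral_map (hm 0).aemeasurable hH.aestronglyMeasurable]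

theorem integral_comp_eq (hε : IsInnovation μ eps) (hG : Measurable G) (j : ℤ) :
    ∫ ω, G (eps j ω) ∂μ = ∫ ω, G (eps 0 ω) ∂μ :=
  ((hε.identDistrib j).comp hG).integral_eq

theorem memLp_mul_and_integral_sq [IsProbabilityMeasure μ] (hε : IsInnovation μ eps)
    (hH : Measurable H)
    (hG : Measurable G) (hH2 : ∀ j : ℤ, MemLp (fun ω => H (past (fun k => eps k ω) j)) 2 μ)
    (hG2 : ∀ j : ℤ, MemLp (fun ω => G (eps j ω)) 2 μ) (j : ℤ) :
    MemLp (fun ω => H (past (fun k => eps k ω) j) * G (eps j ω)) 2 μ ∧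
      ∫ ω, (H (past (fun k => eps k ω) j) * G (eps j ω)) ^ 2 ∂μ =
        (∫ ω, H (past (fun k => eps k ω) 0) ^ 2 ∂μ) * ∫ ω, G (eps 0 ω) ^ 2 ∂μ := by
  have hind : IndepFun (fun ω => H (past (fun k => eps k ω) j) ^ 2) (fun ω => G (eps j ω) ^ 2) μ :=
    hε.indepFun_of_measurable_pastField (G := fun x => G x ^ 2)
      ((hH.comp (measurable_past fun k hk => measurable_pastField hk)).pow_const 2)
      (hG.pow_const 2)
  constructor
  · refine (memLp_two_iff_integrable_sq
      (f := fun ω => H (past (fun k => eps k ω) j) * G (eps j ω))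
      ((hH2 j).1.mul (hG2 j).1)).mpr ?_
    simp only [mul_pow]
    exact hind.integrable_mul (hH2 j).integrable_sq (hG2 j).integrable_sq
  · simp only [mul_pow]
    rw [hind.integral_fun_mul_eq_mul_integral (hH2 j).integrable_sq.1 (hG2 j).integrable_sq.1,
      hε.integral_past_eq (H := fun x => H x ^ 2) (hH.pow_const 2),
      hε.integral_comp_eq (G := fun x => G x ^ 2) (hG.pow_const 2)]

/-- Martingale differences are orthogonal: the cross term vanishes because `G(ε_{n+1})` is centred
and independent of the partial sum times the next coefficient. -/
theorem memLp_sum_and_integral_sq [IsProbabilityMeasure μ] (hε : IsInnovation μ eps)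
    (hH : Measurable H)
    (hG : Measurable G) (hH2 : ∀ j : ℤ, MemLp (fun ω => H (past (fun k => eps k ω) j)) 2 μ)
    (hG2 : ∀ j : ℤ, MemLp (fun ω => G (eps j ω)) 2 μ) (hG0 : ∀ j : ℤ, ∫ ω, G (eps j ω) ∂μ = 0)
    (n : ℕ) :
    MemLp (fun ω => ∑ j ∈ Finset.Icc 1 n, H (past (fun k => eps k ω) j) * G (eps j ω)) 2 μ ∧
      ∫ ω, (∑ j ∈ Finset.Icc 1 n, H (past (fun k => eps k ω) j) * G (eps j ω)) ^ 2 ∂μ =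
        n * ((∫ ω, H (past (fun k => eps k ω) 0) ^ 2 ∂μ) * ∫ ω, G (eps 0 ω) ^ 2 ∂μ) := by
  induction n with
  | zero => simp
  | succ n ih =>
    obtain ⟨ihm, ihi⟩ := ih
    set T : Ω → ℝ := fun ω => ∑ j ∈ Finset.Icc 1 n, H (past (fun k => eps k ω) j) * G (eps j ω)
    obtain ⟨hDm, hDi⟩ := hε.memLp_mul_and_integral_sq hH hG hH2 hG2 (n + 1 : ℕ)
    set P : Ω → ℝ := fun ω => H (past (fun k => eps k ω) (n + 1 : ℕ))
    have hTm : Measurable[pastField eps (n + 1 : ℕ)] T := by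
      refine Finset.measurable_fun_sum _ fun j hj => ?_
      have hjn : (j : ℤ) < (n + 1 : ℕ) := by
        have := (Finset.mem_Icc.mp hj).2
        exact_mod_cast Nat.lt_succ_of_le this
      exact (hH.comp (measurable_past fun k hk => measurable_pastField (hk.trans hjn))).mul
        (hG.comp (measurable_pastField hjn))
    have hPm : Measurable[pastField eps (n + 1 : ℕ)] P :=
      hH.comp (measurable_past fun k hk => measurable_pastField hk)
    have hind : IndepFun (fun ω => T ω * P ω) (fun ω => G (eps (n + 1 : ℕ) ω)) μ :=
      hε.indepFun_of_measurable_pastField (hTm.mul hPm) hG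
    have hTP : Integrable (fun ω => T ω * P ω) μ := ihm.integrable_mul (hH2 _)
    have hGi := (hG2 (n + 1 : ℕ)).integrable one_le_two
    have hcross : ∫ ω, T ω * P ω * G (eps (n + 1 : ℕ) ω) ∂μ = 0 := by
      rw [hind.integral_fun_mul_eq_mul_integral hTP.1 hGi.1, hG0, mul_zero]
    have hsum : ∀ ω, ∑ j ∈ Finset.Icc 1 (n + 1), H (past (fun k => eps k ω) j) * G (eps j ω) =
        T ω + P ω * G (eps (n + 1 : ℕ) ω) := fun ω => by
      rw [Finset.sum_Icc_succ_top (by omega)]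
    simp only [hsum]
    refine ⟨ihm.add hDm, ?_⟩
    have hexp : ∀ ω, (T ω + P ω * G (eps (n + 1 : ℕ) ω)) ^ 2 =
        T ω ^ 2 + 2 * (T ω * P ω * G (eps (n + 1 : ℕ) ω)) +
          (P ω * G (eps (n + 1 : ℕ) ω)) ^ 2 := fun ω => by ring
    simp only [hexp]
    have hcr : Integrable (fun ω => 2 * (T ω * P ω * G (eps (n + 1 : ℕ) ω))) μ :=
      (hind.integrable_mul hTP hGi).const_mul 2
    have hTs : Integrable (fun ω => T ω ^ 2 + 2 * (T ω * P ω * G (eps (n + 1 : ℕ) ω))) μ :=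
      ihm.integrable_sq.add hcr
    have hDs : Integrable (fun ω => (P ω * G (eps (n + 1 : ℕ) ω)) ^ 2) μ := hDm.integrable_sq
    rw [integral_add hTs hDs,
      integral_add ihm.integrable_sq hcr, integral_const_mul, hcross, ihi, hDi]
    push_cast
    ring

/-- The weak law of large numbers for the martingale differences `H(ε_{j-1}, …) G(ε_j)`. -/
theorem tendstoInMeasure_average [IsProbabilityMeasure μ] (hε : IsInnovation μ eps)
    (hH : Measurable H)
    (hG : Measurable G) (hH2 : ∀ j : ℤ, MemLp (fun ω => H (past (fun k => eps k ω) j)) 2 μ)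
    (hG2 : ∀ j : ℤ, MemLp (fun ω => G (eps j ω)) 2 μ) (hG0 : ∀ j : ℤ, ∫ ω, G (eps j ω) ∂μ = 0) :
    TendstoInMeasure μ (fun (n : ℕ) ω => (n : ℝ)⁻¹ *
      ∑ j ∈ Finset.Icc 1 n, H (past (fun k => eps k ω) j) * G (eps j ω)) atTop 0 := by
  set B := (∫ ω, H (past (fun k => eps k ω) 0) ^ 2 ∂μ) * ∫ ω, G (eps 0 ω) ^ 2 ∂μ with hB
  rw [tendstoInMeasure_iff_measureReal_norm]
  intro δ hδ
  have hlim : Tendsto (fun n : ℕ => B / δ ^ 2 / (n : ℝ)) atTop (𝓝 0) :=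
    tendsto_const_div_atTop_nhds_zero_nat _
  refine squeeze_zero' (Eventually.of_forall fun _ => measureReal_nonneg) ?_ hlim
  filter_upwards [eventually_ge_atTop 1] with n hn
  have hn0 : (0 : ℝ) < n := by exact_mod_cast hn
  obtain ⟨hm, hi⟩ := hε.memLp_sum_and_integral_sq hH hG hH2 hG2 hG0 n
  have hmark := mul_meas_ge_le_integral_of_nonneg (μ := μ)
    (Eventually.of_forall fun ω => sq_nonneg _) hm.integrable_sq ((n * δ) ^ 2)
  rw [hi, ← hB] at hmark
  have hset : {ω | δ ≤ ‖(n : ℝ)⁻¹ * ∑ j ∈ Finset.Icc 1 n,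
      H (past (fun k => eps k ω) j) * G (eps j ω) - (0 : Ω → ℝ) ω‖} ⊆
      {ω | (n * δ) ^ 2 ≤ (∑ j ∈ Finset.Icc 1 n,
        H (past (fun k => eps k ω) j) * G (eps j ω)) ^ 2} := by
    intro ω hω
    simp only [Pi.zero_apply, sub_zero, norm_mul, norm_inv, Real.norm_eq_abs, Nat.abs_cast,
      Set.mem_ofPred_eq] at hω ⊢
    rw [sq_le_sq, abs_of_pos (by positivity)]
    rw [inv_mul_eq_div, le_div_iff₀ hn0] at hω
    linarith
  refine (measureReal_mono hset).trans ?_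
  rw [div_div, le_div_iff₀ (by positivity)]
  have h2 : (n : ℝ) * (μ.real {ω | (n * δ) ^ 2 ≤ (∑ j ∈ Finset.Icc 1 n,
      H (past (fun k => eps k ω) j) * G (eps j ω)) ^ 2} * (δ ^ 2 * n)) ≤ n * B := by
    calc _ = (n * δ) ^ 2 * μ.real {ω | (n * δ) ^ 2 ≤ (∑ j ∈ Finset.Icc 1 n,
      H (past (fun k => eps k ω) j) * G (eps j ω)) ^ 2} := by ring
      _ ≤ _ := hmark
  exact le_of_mul_le_mul_left h2 hn0

end IsInnovation

theorem tendstoInMeasure_zero_of_norm_le_sum {E ι : Type*} [NormedAddCommGroup E] [Fintype ι]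
    {f : ℕ → Ω → E} {Z : ι → ℕ → Ω → ℝ} (hZ : ∀ i, TendstoInMeasure μ (Z i) atTop 0)
    (hf : ∀ n ω, ‖f n ω‖ ≤ ∑ i, |Z i n ω|) : TendstoInMeasure μ f atTop 0 := by
  rw [tendstoInMeasure_iff_norm]
  intro δ hδ
  -- With `+ 1`, the definition also covers an empty `ι`, and `card ι * a` is strictly below `δ`.
  set a : ℝ := δ / (Fintype.card ι + 1)
  have ha : 0 < a := by positivity
  have hsum : Tendsto (fun n => ∑ i, μ {ω | a ≤ ‖Z i n ω - (0 : Ω → ℝ) ω‖}) atTop (𝓝 0) := by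
    simpa using tendsto_finsetSum Finset.univ fun i _ => tendstoInMeasure_iff_norm.mp (hZ i) a ha
  refine tendsto_of_tendsto_of_tendsto_of_le_of_le tendsto_const_nhds hsum
    (fun _ => zero_le) fun n => ?_
  refine (measure_mono fun ω hω => ?_).trans (measure_iUnion_fintype_le μ _)
  by_contra hcon
  simp only [Pi.zero_apply, sub_zero, Real.norm_eq_abs, Set.mem_iUnion, Set.mem_ofPred_eq,
    not_exists, not_le] at hcon hω
  have h1 : ∑ i, |Z i n ω| ≤ ∑ _i : ι, a := Finset.sum_le_sum fun i _ => (hcon i).le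
  rw [Finset.sum_const, Finset.card_univ, nsmul_eq_mul] at h1
  have h2 : (Fintype.card ι + 1 : ℝ) * a = δ := by simp only [a]; field_simp
  have := hf n ω
  linarith

/-- Asymptotically linear estimators are consistent. -/
theorem AssumptionA1.tendstoInMeasure [IsProbabilityMeasure μ] {v : ℕ} {θ₀ : Vec v} {θhat : ℕ → Ω → Vec v}
    (hA1 : AssumptionA1 μ θ₀ eps θhat) (hε : IsInnovation μ eps) :
    TendstoInMeasure μ θhat atTop fun _ => θ₀ := by
  obtain ⟨g, h, hg, hh, hg0, hg2, hh2, hlin⟩ := hA1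
  have hm : ∀ j, Measurable fun ω => past (fun k => eps k ω) j :=
    fun j => measurable_past fun k _ => hε.measurable k
  have hgm : ∀ b, Measurable fun x => g x b := fun b => by fun_prop
  have hG2 : ∀ b (j : ℤ), MemLp (fun ω => g (eps j ω) b) 2 μ := by
    intro b j
    have hmeas : Measurable fun ω => g (eps j ω) b := (hgm b).comp (hε.measurable j)
    rw [memLp_two_iff_integrable_sq hmeas.aestronglyMeasurable]
    refine (hg2 j).mono' (hmeas.pow_const 2).aestronglyMeasurable (Eventually.of_forall fun ω => ?_)
    rw [Real.norm_eq_abs, abs_of_nonneg (sq_nonneg _)]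
    exact Finset.single_le_sum (f := fun a => g (eps j ω) a ^ 2) (fun _ _ => sq_nonneg _)
      (Finset.mem_univ b)
  have hH2 : ∀ a b (j : ℤ), MemLp (fun ω => h (past (fun k => eps k ω) j) a b) 2 μ := by
    intro a b j
    have hmeas : Measurable fun ω => h (past (fun k => eps k ω) j) a b := (hh a b).comp (hm j)
    rw [memLp_two_iff_integrable_sq hmeas.aestronglyMeasurable]
    -- A squared entry of `h` is at most a diagonal entry of `h hᵀ`, hence at most `l1Norm (h hᵀ) ≤
    -- 1 + l1Norm (h hᵀ) ^ 2`.
    refine ((integrable_const (1 : ℝ)).add (hh2 j)).mono' (hmeas.pow_const 2).aestronglyMeasurable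
      (Eventually.of_forall fun ω => ?_)
    rw [Real.norm_eq_abs, abs_of_nonneg (sq_nonneg _), Pi.add_apply]
    set A := h (past (fun k => eps k ω) j)
    have h1 : A a b ^ 2 ≤ (A * A.transpose) a a := by
      rw [Matrix.mul_apply]
      simp only [Matrix.transpose_apply, ← pow_two]
      exact Finset.single_le_sum (f := fun b => A a b ^ 2) (fun _ _ => sq_nonneg _)
        (Finset.mem_univ b)
    have h2 := (le_abs_self _).trans (abs_apply_le_l1Norm (A * A.transpose) a a)
    nlinarith [sq_nonneg (l1Norm (A * A.transpose) - 1)]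
  have havg : TendstoInMeasure μ (fun (n : ℕ) ω => (n : ℝ)⁻¹ • ∑ j ∈ Finset.Icc 1 n,
      matVec (h (past (fun k => eps k ω) j)) (g (eps j ω))) atTop 0 := by
    refine tendstoInMeasure_zero_of_norm_le_sum
      (Z := fun (p : Fin v × Fin (d ^ 2)) (n : ℕ) ω => (n : ℝ)⁻¹ * ∑ j ∈ Finset.Icc 1 n,
        h (past (fun k => eps k ω) j) p.1 p.2 * g (eps j ω) p.2)
      (fun p => hε.tendstoInMeasure_average (H := fun x => h x p.1 p.2) (G := fun x => g x p.2)
        (hh _ _) (hgm _) (hH2 _ _) (hG2 _) fun j => hg0 j _) fun n ω => ?_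
    rw [Fintype.sum_prod_type]
    refine (norm_le_sum_abs _).trans (Finset.sum_le_sum fun a _ => ?_)
    refine le_trans (le_of_eq ?_) (Finset.abs_sum_le_sum_abs _ _)
    congr 1
    simp only [PiLp.smul_apply, WithLp.ofLp_sum, Finset.sum_apply, smul_eq_mul, matVec,
      Matrix.mulVec, dotProduct]
    rw [Finset.sum_comm, Finset.mul_sum]
  rw [tendstoInMeasure_iff_norm] at hlin havg ⊢
  intro δ hδ
  have hsum := (hlin (δ / 2) (half_pos hδ)).add (havg (δ / 2) (half_pos hδ))
  rw [add_zero] at hsum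
  refine tendsto_of_tendsto_of_tendsto_of_le_of_le' tendsto_const_nhds hsum
    (Eventually.of_forall fun _ => zero_le) ?_
  filter_upwards [eventually_ge_atTop 1] with n hn
  refine (measure_mono fun ω hω => ?_).trans (measure_union_le _ _)
  by_contra hcon
  simp only [Set.mem_union, Set.mem_ofPred_eq, Pi.zero_apply, sub_zero, not_or, not_le] at hcon hω
  obtain ⟨h1, h2⟩ := hcon
  set T := ∑ j ∈ Finset.Icc 1 n, matVec (h (past (fun k => eps k ω) j)) (g (eps j ω))
  have hs1 : (1 : ℝ) ≤ √n := Real.one_le_sqrt.mpr (by exact_mod_cast hn)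
  have hs0 : √(n : ℝ) ≠ 0 := by positivity
  have hsn : (√(n : ℝ))⁻¹ * (√(n : ℝ))⁻¹ = (n : ℝ)⁻¹ := by
    rw [← mul_inv, Real.mul_self_sqrt (Nat.cast_nonneg n)]
  -- The estimation error is `n^{-1/2}` times the linearisation remainder plus the average of the
  -- `L_j`; both are small in probability.
  have hdecomp : θhat n ω - θ₀ =
      (√(n : ℝ))⁻¹ • (√(n : ℝ) • (θhat n ω - θ₀) - (√(n : ℝ))⁻¹ • T) + (n : ℝ)⁻¹ • T := by
    rw [smul_sub, smul_smul, smul_smul, hsn, inv_mul_cancel₀ hs0, one_smul, sub_add_cancel]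
  rw [hdecomp] at hω
  have h3 := norm_add_le ((√(n : ℝ))⁻¹ • (√(n : ℝ) • (θhat n ω - θ₀) - (√(n : ℝ))⁻¹ • T))
    ((n : ℝ)⁻¹ • T)
  have h4 : ‖(√(n : ℝ))⁻¹ • (√(n : ℝ) • (θhat n ω - θ₀) - (√(n : ℝ))⁻¹ • T)‖ ≤
      ‖√(n : ℝ) • (θhat n ω - θ₀) - (√(n : ℝ))⁻¹ • T‖ := by
    rw [norm_smul, norm_inv, Real.norm_eq_abs, abs_of_nonneg (by positivity)]
    exact mul_le_of_le_one_left (norm_nonneg _) (inv_le_one_of_one_le₀ hs1)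
  linarith

end Consistency

/-! ### Closeness of residuals and innovations -/

section Residuals

variable {d v : ℕ} {Ω : Type*} [MeasurableSpace Ω] {μ : Measure Ω}

theorem exists_measure_le_of_antitone [IsFiniteMeasure μ] {s : ℕ → Set Ω}
    (hs : ∀ m, MeasurableSet (s m)) (hanti : Antitone s) (h0 : μ (⋂ m, s m) = 0) {ξ : ℝ≥0∞}
    (hξ : 0 < ξ) : ∃ m, μ (s m) ≤ ξ := by
  have h := tendsto_measure_iInter_atTop (fun m => (hs m).nullMeasurableSet) hanti
    ⟨0, measure_ne_top μ _⟩
  rw [h0] at h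
  exact (h.eventually (ge_mem_nhds hξ)).exists

open scoped Classical in
-- Markov's inequality for the number of events that occur; no independence is needed.
theorem measure_le_card_filter_le {B : ℕ → Set Ω} (hB : ∀ j, MeasurableSet (B j)) {p : ℝ≥0∞}
    (hp : ∀ j, μ (B j) ≤ p) {a : ℝ} (ha : 0 < a) {n : ℕ} (hn : 1 ≤ n) :
    μ {ω | a * n ≤ (((Finset.Icc 1 n).filter fun j => ω ∈ B j).card : ℝ)} ≤
      p / ENNReal.ofReal a := by
  have hn0 : (n : ℝ≥0∞) ≠ 0 := by exact_mod_cast (by omega : n ≠ 0)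
  have ha0 : ENNReal.ofReal a ≠ 0 := by simpa using ha
  set f : Ω → ℝ≥0∞ := fun ω => ∑ j ∈ Finset.Icc 1 n, (B j).indicator 1 ω with hf
  have hfm : Measurable f := Finset.measurable_fun_sum _ fun j _ => measurable_one.indicator (hB j)
  have hcard : ∀ ω, f ω = (((Finset.Icc 1 n).filter fun j => ω ∈ B j).card : ℝ≥0∞) := fun ω => by
    simp [hf, Set.indicator_apply, Finset.sum_boole]
  have hint : ∫⁻ ω, f ω ∂μ ≤ n * p := by
    rw [hf, lintegral_finsetSum _ fun j _ => measurable_one.indicator (hB j)]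
    refine (Finset.sum_le_card_nsmul _ _ p fun j _ => ?_).trans (by simp)
    rw [lintegral_indicator_one (hB j)]
    exact hp j
  have hmark := (mul_meas_ge_le_lintegral (μ := μ) hfm (ENNReal.ofReal a * n)).trans hint
  have hset : {ω | a * n ≤ (((Finset.Icc 1 n).filter fun j => ω ∈ B j).card : ℝ)} ⊆
      {ω | ENNReal.ofReal a * n ≤ f ω} := by
    intro ω hω
    rw [Set.mem_ofPred_eq, hcard, ← ENNReal.ofReal_natCast n, ← ENNReal.ofReal_mul ha.le,
      ← ENNReal.ofReal_natCast]
    exact ENNReal.ofReal_le_ofReal hω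
  refine (measure_mono hset).trans ?_
  rw [ENNReal.le_div_iff_mul_le (Or.inl ha0) (Or.inl ENNReal.ofReal_ne_top)]
  rw [mul_right_comm, mul_comm _ (n : ℝ≥0∞), mul_comm (ENNReal.ofReal a)] at hmark
  exact (ENNReal.mul_le_mul_iff_right hn0 (ENNReal.natCast_ne_top n)).mp hmark

variable {S : Vec v → (ℕ → Vec d) → Matrix (Fin d) (Fin d) ℝ} {Θ : Set (Vec v)} {θ₀ : Vec v}
  {eps X : ℤ → Ω → Vec d} {xinit : ℤ → Vec d}

theorem IsStationaryGARCH.measurable (hX : IsStationaryGARCH μ S θ₀ eps X)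
    (hε : ∀ j, Measurable (eps j)) (j : ℤ) : Measurable (X j) :=
  (hX.adapted j).mono (iSup_le fun u => (hε u).comap_le) le_rfl

theorem IsStationaryGARCH.measure_past_mem (hX : IsStationaryGARCH μ S θ₀ eps X)
    (hXm : ∀ j, Measurable (X j)) {G : Set (ℕ → Vec d)} (hG : MeasurableSet G) (j : ℤ) :
    μ {ω | past (fun k => X k ω) j ∈ G} = μ {ω | past (fun k => X k ω) 0 ∈ G} := by
  have hp : Measurable fun x : ℤ → Vec d => past x 0 :=
    measurable_pi_iff.mpr fun i => measurable_pi_apply _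
  have h := congrArg (fun ν => ν ((fun x : ℤ → Vec d => past x 0) ⁻¹' G)) (hX.stationary j)
  beta_reduce at h
  rw [Measure.map_apply (measurable_pi_iff.mpr fun k => hXm _) (hp hG),
    Measure.map_apply (measurable_pi_iff.mpr fun k => hXm _) (hp hG)] at h
  rw [show {ω | past (fun k => X k ω) 0 ∈ G} =
    (fun ω j => X j ω) ⁻¹' ((fun x : ℤ → Vec d => past x 0) ⁻¹' G) from rfl, ← h]
  congr 1
  ext ω
  have : past (fun k => X (k + j) ω) 0 = past (fun k => X k ω) j := by
    funext i
    simp only [past]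
    congr 1
    ring
  simp only [Set.mem_ofPred_eq, Set.mem_preimage, this]

theorem IsVolatility.measurable_root (hS : IsVolatility Θ S) {θ : Vec v} (hθ : θ ∈ Θ)
    (a b : Fin d) : Measurable fun x => matSqrt (S θ x) a b :=
  measurable_matSqrt_apply (hS.measurable θ hθ) (fun x => (hS.posDef θ hθ x).posSemidef) a b

theorem measurable_l1Norm {α : Type*} [MeasurableSpace α] {m n : ℕ}
    {A : α → Matrix (Fin m) (Fin n) ℝ} (hA : ∀ a b, Measurable fun x => A x a b) :
    Measurable fun x => l1Norm (A x) :=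
  Finset.measurable_fun_sum _ fun a _ => Finset.measurable_fun_sum _ fun b _ => (hA a b).abs

theorem continuousOn_l1Norm {α : Type*} [TopologicalSpace α] {s : Set α} {m n : ℕ}
    {A : α → Matrix (Fin m) (Fin n) ℝ} (hA : ∀ a b, ContinuousOn (fun x => A x a b) s) :
    ContinuousOn (fun x => l1Norm (A x)) s :=
  continuousOn_finsetSum _ fun a _ => continuousOn_finsetSum _ fun b _ => (hA a b).abs

/-- The volatility root varies little near `θ₀`, outside a set of pasts of small probability. -/
theorem exists_past_set [IsProbabilityMeasure μ] (hθ₀ : θ₀ ∈ Θ) (hS : IsVolatility Θ S)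
    (hcont : ∀ x a b, ContinuousOn (fun θ => matSqrt (S θ x) a b) Θ)
    (hXm : ∀ j, Measurable (X j)) {κ : ℝ} (hκ : 0 < κ) {ξ : ℝ≥0∞} (hξ : 0 < ξ) :
    ∃ δ > 0, ∃ G : Set (ℕ → Vec d), MeasurableSet G ∧
      μ {ω | past (fun k => X k ω) 0 ∈ G} ≤ ξ ∧
      ∀ x ∉ G, ∀ θ ∈ Θ, ‖θ - θ₀‖ < δ → l1Norm (matSqrt (S θ₀ x) - matSqrt (S θ x)) ≤ κ := by
  set F : Vec v → (ℕ → Vec d) → ℝ := fun θ x => l1Norm (matSqrt (S θ₀ x) - matSqrt (S θ x)) with hF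
  have hFm : ∀ θ ∈ Θ, Measurable (F θ) := fun θ hθ =>
    measurable_l1Norm fun a b => (hS.measurable_root hθ₀ a b).sub (hS.measurable_root hθ a b)
  have hFc : ∀ x, ContinuousOn (fun θ => F θ x) Θ := fun x =>
    continuousOn_l1Norm fun a b => continuousOn_const.sub (hcont x a b)
  set δ : ℕ → ℝ := fun m => 1 / ((m : ℝ) + 1)
  have hδ : ∀ m, 0 < δ m := fun m => Nat.one_div_pos_of_nat
  -- These exceptional sets decrease to the empty set by continuity at `θ₀`, so one of them has
  -- small probability.
  set G : ℕ → Set (ℕ → Vec d) := fun m => {x | ∀ θ ∈ Θ ∩ Metric.ball θ₀ (δ m), F θ x ≤ κ}ᶜ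
  have hGm : ∀ m, MeasurableSet (G m) := fun m =>
    (measurableSet_forall_le (fun x => (hFc x).mono Set.inter_subset_left)
      (fun θ hθ => hFm θ hθ.1) κ).compl
  have hpast : Measurable fun ω => past (fun k => X k ω) 0 := measurable_past fun k _ => hXm k
  have hGanti : Antitone G := by
    intro m m' h
    refine Set.compl_subset_compl.mpr fun x hx θ hθ => hx θ ⟨hθ.1, ?_⟩
    exact Metric.ball_subset_ball (Nat.one_div_le_one_div h) hθ.2
  have hGempty : ⋂ m, G m = ∅ := by
    refine Set.eq_empty_of_forall_notMem fun x hx => ?_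
    have h0 : F θ₀ x = 0 := by simp [hF, l1Norm]
    have hev : ∀ᶠ θ in 𝓝[Θ] θ₀, F θ x < κ :=
      (hFc x θ₀ hθ₀).eventually (gt_mem_nhds (show F θ₀ x < κ by rwa [h0]))
    rw [eventually_nhdsWithin_iff, Metric.eventually_nhds_iff] at hev
    obtain ⟨r, hr, hball⟩ := hev
    obtain ⟨m, hm⟩ := exists_nat_one_div_lt hr
    refine Set.mem_iInter.mp hx m fun θ hθ => ?_
    exact (hball ((Metric.mem_ball.mp hθ.2).trans hm) hθ.1).le
  obtain ⟨m, hm⟩ := exists_measure_le_of_antitone (μ := μ)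
    (s := fun m => (fun ω => past (fun k => X k ω) 0) ⁻¹' G m) (fun m => hpast (hGm m))
    (fun m m' h => Set.preimage_mono (hGanti h))
    (by rw [← Set.preimage_iInter, hGempty]; simp) hξ
  refine ⟨δ m, hδ m, G m, hGm m, hm, fun x hx θ hθ hθδ => ?_⟩
  exact Set.notMem_compl_iff.mp hx θ ⟨hθ, by rwa [Metric.mem_ball, dist_eq_norm]⟩

/-- The random constant in (A.3) is bounded outside an event of small probability. -/
theorem exists_bound_of_assumptionA3 [IsProbabilityMeasure μ] (hS : IsVolatility Θ S)
    (hcont : ∀ x a b, ContinuousOn (fun θ => matSqrt (S θ x) a b) Θ)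
    (hXm : ∀ j, Measurable (X j)) {ρ : ℝ} (hρ : 0 < ρ)
    (h : ∀ᵐ ω ∂μ, ∃ C : ℝ, 0 < C ∧ ∀ j : ℕ, 1 ≤ j → ∀ θ ∈ Θ,
      l1Norm (volRoot S (fun k => X k ω) j θ -
        volRoot S (initPath xinit fun k => X k ω) j θ) ≤ C * ρ ^ j) {ξ : ℝ≥0∞} (hξ : 0 < ξ) :
    ∃ N : ℕ, μ {ω | ∀ j : ℕ, 1 ≤ j → ∀ θ ∈ Θ, l1Norm (volRoot S (fun k => X k ω) j θ -
      volRoot S (initPath xinit fun k => X k ω) j θ) ≤ N * ρ ^ j}ᶜ ≤ ξ := by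
  have hinit : ∀ j, Measurable fun ω => initPath xinit (fun k => X k ω) j := by
    intro j
    unfold initPath
    split_ifs
    · exact hXm j
    · exact measurable_const
  refine exists_measure_le_of_antitone (fun N => MeasurableSet.compl ?_) ?_ ?_ hξ
  · simp only [Set.ofPred_forall]
    refine MeasurableSet.iInter fun j => MeasurableSet.iInter fun _ => ?_
    simp only [← Set.ofPred_forall]
    refine measurableSet_forall_le (F := fun θ ω => l1Norm (volRoot S (fun k => X k ω) j θ -
      volRoot S (initPath xinit fun k => X k ω) j θ)) (fun ω => ?_) (fun θ hθ => ?_) _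
    · exact continuousOn_l1Norm fun a b => (hcont _ a b).sub (hcont _ a b)
    · exact measurable_l1Norm fun a b =>
        ((hS.measurable_root hθ a b).comp (measurable_past fun k _ => hXm k)).sub
          ((hS.measurable_root hθ a b).comp
            (measurable_past (X := fun k ω => initPath xinit (fun k => X k ω) k)
              fun k _ => hinit k))
  · intro N N' hN
    refine Set.compl_subset_compl.mpr fun ω hω j hj θ hθ => (hω j hj θ hθ).trans ?_
    gcongr
  · rw [← Set.compl_iUnion]
    change ∀ᵐ ω ∂μ, ω ∈ ⋃ N : ℕ, _
    filter_upwards [h] with ω ⟨C, _, hω⟩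
    obtain ⟨N, hN⟩ := exists_nat_ge C
    refine Set.mem_iUnion.mpr ⟨N, fun j hj θ hθ => (hω j hj θ hθ).trans ?_⟩
    gcongr

/-- The error equals `Σ̃^{-1/2}(θ) (Σ^{1/2}(θ₀) - Σ̃^{1/2}(θ)) e`; the middle factor splits at
`Σ^{1/2}(θ)`. -/
theorem norm_garchResidual_sub_le (hS : IsVolatility Θ S) {x : ℤ → Vec d} {θ : Vec v}
    (hθ : θ ∈ Θ) {j : ℕ} {e : Vec d} (hx : x j = matVec (volRoot S x j θ₀) e) {C κ K : ℝ}
    (hC0 : 0 ≤ C) (hκ0 : 0 ≤ κ) (hC : l1Norm (volRoot S (initPath xinit x) j θ)⁻¹ ≤ C)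
    (h1 : l1Norm (volRoot S x j θ₀ - volRoot S x j θ) ≤ κ)
    (h2 : l1Norm (volRoot S x j θ - volRoot S (initPath xinit x) j θ) ≤ κ) (he : ‖e‖ ≤ K) :
    ‖garchResidual S xinit x θ j - e‖ ≤ C * (2 * κ * K) := by
  rw [garchResidual, hx, matVec_inv_sub (B := volRoot S (initPath xinit x) j θ)
    (isUnit_det_matSqrt (hS.posDef θ hθ _))]
  have h3 : l1Norm (volRoot S x j θ₀ - volRoot S (initPath xinit x) j θ) ≤ 2 * κ := by
    rw [← sub_add_sub_cancel _ (volRoot S x j θ)]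
    linarith [l1Norm_add_le (volRoot S x j θ₀ - volRoot S x j θ)
      (volRoot S x j θ - volRoot S (initPath xinit x) j θ)]
  refine (norm_matVec_le _ _).trans (mul_le_mul hC ?_ (norm_nonneg _) hC0)
  exact (norm_matVec_le _ _).trans (mul_le_mul h3 he (norm_nonneg _) (by positivity))

/-- Under (A.2), (A.3) and smoothness of the volatility, most residuals are close to the
innovations when the estimator is consistent. -/
theorem tendsto_measure_card_residual [IsProbabilityMeasure μ] (hθ₀ : θ₀ ∈ Θ)
    (hS : IsVolatility Θ S) (hε : IsInnovation μ eps) (hX : IsStationaryGARCH μ S θ₀ eps X)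
    {θhat : ℕ → Ω → Vec v} (hθhatΘ : ∀ n ω, θhat n ω ∈ Θ)
    (hθhat : TendstoInMeasure μ θhat atTop fun _ => θ₀)
    (hA2 : AssumptionA2 μ Θ S xinit X) (hA3 : AssumptionA3 μ Θ S xinit X)
    (hcont : ∀ x a b, ContinuousOn (fun θ => matSqrt (S θ x) a b) Θ) {γ : ℝ} (hγ : 0 < γ) :
    Tendsto (fun n : ℕ => μ {ω | γ < (((Finset.Icc 1 n).filter fun j : ℕ =>
      ¬ ‖garchResidual S xinit (fun k => X k ω) (θhat n ω) j - eps j ω‖ ≤ γ).card : ℝ) / n})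
      atTop (𝓝 0) := by
  classical
  obtain ⟨C, hC, hA2⟩ := hA2
  obtain ⟨ρ, hρ0, hρ1, hA3⟩ := hA3
  have hXm := hX.measurable hε.measurable
  rw [ENNReal.tendsto_nhds_zero]
  intro ζ hζ
  have hζ3 : 0 < ζ / 3 := ENNReal.div_pos hζ.ne' (by simp)
  -- Markov's inequality at level `γ / 2` turns `ξ` into `ζ / 3`. Half of `ξ` is spent on large
  -- innovations, half on exceptional pasts.
  set ξ : ℝ≥0∞ := ζ / 3 * ENNReal.ofReal (γ / 2) with hξdef
  have hγ2 : 0 < ENNReal.ofReal (γ / 2) := by simpa using hγ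
  have hξ : 0 < ξ := ENNReal.mul_pos hζ3.ne' hγ2.ne'
  have hξ2 : 0 < ξ / 2 := ENNReal.half_pos hξ.ne'
  obtain ⟨K, hK⟩ : ∃ K : ℕ, μ {ω | (K : ℝ) < ‖eps 0 ω‖} ≤ ξ / 2 := by
    refine exists_measure_le_of_antitone
      (fun K => measurableSet_lt measurable_const (hε.measurable 0).norm)
      (fun K K' h ω hω => lt_of_le_of_lt (by exact_mod_cast h) (show (K' : ℝ) < _ from hω)) ?_ hξ2
    have : ⋂ K : ℕ, {ω | (K : ℝ) < ‖eps 0 ω‖} = ∅ := by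
      refine Set.eq_empty_of_forall_notMem fun ω hω => ?_
      obtain ⟨K, hK⟩ := exists_nat_ge ‖eps 0 ω‖
      exact absurd (Set.mem_iInter.mp hω K) (not_lt.mpr hK)
    rw [this, measure_empty]
  -- This makes the bound of `norm_garchResidual_sub_le` at most `γ`; `K + 1` avoids division by
  -- zero.
  set κ : ℝ := γ / (2 * C * (K + 1)) with hκdef
  have hκ : 0 < κ := by positivity
  have hκγ : C * (2 * κ * K) ≤ γ := by
    have h : C * (2 * κ * (K + 1)) = γ := by rw [hκdef]; field_simp
    have : 0 ≤ C * (2 * κ) := by positivity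
    linarith
  obtain ⟨δ, hδ, G, hGm, hG, hGκ⟩ := exists_past_set (μ := μ) hθ₀ hS hcont hXm hκ hξ2
  obtain ⟨N, hN⟩ := exists_bound_of_assumptionA3 hS hcont hXm hρ0 hA3 hζ3
  set B : ℕ → Set Ω := fun j => {ω | (K : ℝ) < ‖eps j ω‖} ∪ {ω | past (fun k => X k ω) j ∈ G}
  have hBm : ∀ j, MeasurableSet (B j) := fun j =>
    (measurableSet_lt measurable_const (hε.measurable j).norm).union
      ((measurable_past fun k _ => hXm k) hGm)
  have hBp : ∀ j, μ (B j) ≤ ξ := by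
    intro j
    have hid : μ {ω | (K : ℝ) < ‖eps j ω‖} = μ {ω | (K : ℝ) < ‖eps 0 ω‖} :=
      (hε.identDistrib j).measure_mem_eq (s := {x | (K : ℝ) < ‖x‖})
        (measurableSet_lt measurable_const measurable_norm)
    refine (measure_union_le _ _).trans ?_
    rw [hid, hX.measure_past_mem hXm hGm, ← ENNReal.add_halves ξ]
    exact add_le_add hK hG
  have hlim : Tendsto (fun j => (N : ℝ) * ρ ^ j) atTop (𝓝 0) := by
    simpa using (tendsto_pow_atTop_nhds_zero_of_lt_one hρ0.le hρ1).const_mul (N : ℝ)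
  obtain ⟨j₀, hj₀⟩ := eventually_atTop.mp (hlim.eventually (gt_mem_nhds hκ))
  have hlarge : ∀ᶠ n : ℕ in atTop, (j₀ : ℝ) ≤ γ / 2 * n :=
    (tendsto_natCast_atTop_atTop.const_mul_atTop (half_pos hγ)).eventually_ge_atTop _
  have hae : ∀ᵐ ω ∂μ, (∀ j, X j ω = matVec (volRoot S (fun k => X k ω) j θ₀) (eps j ω)) ∧
      ∀ j : ℕ, 1 ≤ j → ∀ θ ∈ Θ,
        l1Norm (volRoot S (initPath xinit fun k => X k ω) j θ)⁻¹ ≤ C ∧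
        l1Norm (volRoot S (fun k => X k ω) j θ)⁻¹ ≤ C :=
    (ae_all_iff.mpr hX.equation).and hA2
  rw [ae_iff] at hae
  have hcons := (tendstoInMeasure_iff_norm.mp hθhat δ hδ).eventually (ge_mem_nhds hζ3)
  filter_upwards [hcons, hlarge, eventually_ge_atTop 1] with n hn1 hn2 hn3
  have hn0 : (0 : ℝ) < n := by exact_mod_cast hn3
  have hBn := measure_le_card_filter_le hBm hBp (half_pos hγ) hn3
  rw [hξdef, ENNReal.mul_div_cancel_right hγ2.ne' ENNReal.ofReal_ne_top] at hBn
  -- The four exceptional events are a null set, a distant estimate, a large constant in (A.3) and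
  -- too many bad times; the last three cost `ζ / 3` each.
  refine (measure_mono (fun ω hω => ?_)).trans (((measure_union_le _ _).trans (add_le_add
    ((measure_union_le _ _).trans (add_le_add ((measure_union_le _ _).trans
      (add_le_add hae.le hn1)) hN)) hBn)).trans ?_)
  · by_contra hcon
    simp only [Set.mem_union, not_or] at hcon
    obtain ⟨⟨⟨hgood, hθn⟩, hNω⟩, hcount⟩ := hcon
    obtain ⟨heq, hinv⟩ := not_not.mp hgood
    rw [Set.mem_ofPred_eq, not_le] at hθn
    have hNω' := Set.notMem_compl_iff.mp hNω
    rw [Set.mem_ofPred_eq, not_le] at hcount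
    -- A residual can be off only at a time in `B` or before `j₀`; either kind makes up at most `γ /
    -- 2 * n` indices.
    have hsub : ((Finset.Icc 1 n).filter fun j : ℕ =>
        ¬ ‖garchResidual S xinit (fun k => X k ω) (θhat n ω) j - eps j ω‖ ≤ γ) ⊆
        ((Finset.Icc 1 n).filter fun j => ω ∈ B j) ∪ Finset.range j₀ := by
      intro j hj
      obtain ⟨hjI, hjγ⟩ := Finset.mem_filter.mp hj
      have hj1 := (Finset.mem_Icc.mp hjI).1
      by_contra hjn
      simp only [Finset.mem_union, Finset.mem_filter, hjI, true_and, Finset.mem_range, not_or,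
        not_lt] at hjn
      obtain ⟨hjB, hjj₀⟩ := hjn
      obtain ⟨hjK, hjG⟩ := not_or.mp hjB
      refine hjγ (le_trans (norm_garchResidual_sub_le hS (hθhatΘ n ω) (heq j) hC.le hκ.le
        (hinv j hj1 _ (hθhatΘ n ω)).1 (hGκ _ hjG _ (hθhatΘ n ω) hθn) ?_ (not_lt.mp hjK)) hκγ)
      exact (hNω' j hj1 _ (hθhatΘ n ω)).trans (hj₀ j hjj₀).le
    have hcard := (Finset.card_le_card hsub).trans (Finset.card_union_le _ _)
    rw [Finset.card_range] at hcard
    have hcard' : (((Finset.Icc 1 n).filter fun j : ℕ =>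
        ¬ ‖garchResidual S xinit (fun k => X k ω) (θhat n ω) j - eps j ω‖ ≤ γ).card : ℝ) ≤
        ((Finset.Icc 1 n).filter fun j => ω ∈ B j).card + j₀ := by exact_mod_cast hcard
    rw [Set.mem_ofPred_eq, lt_div_iff₀ hn0] at hω
    have hle := hω.trans_le (le_of_eq_of_le (by congr!) hcard')
    have hlt := hle.trans_le (add_le_add (le_of_eq_of_le (by congr!) hcount.le) hn2)
    linarith
  · rw [zero_add, ENNReal.add_thirds]

end Residuals

/-! ### Law of large numbers for the innovations -/

section EmpiricalLimit

variable {d : ℕ} {Ω : Type*} [MeasurableSpace Ω] {μ : Measure Ω} {eps : ℤ → Ω → Vec d}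

theorem IsInnovation.ae_tendsto_empMGF (hε : IsInnovation μ eps)
    (hmgf : ∀ t : Vec d, Integrable (fun ω => Real.exp (inner ℝ t (eps 0 ω))) μ) (t : Vec d) :
    ∀ᵐ ω ∂μ, Tendsto (fun n => empMGF (fun j : ℕ => eps j ω) n t) atTop
      (𝓝 (vecMGF μ (eps 0) t)) := by
  have hf : Measurable fun x : Vec d => Real.exp (inner ℝ t x) := by fun_prop
  have hid : ∀ j, IdentDistrib (fun ω => Real.exp (inner ℝ t (eps j ω)))
      (fun ω => Real.exp (inner ℝ t (eps 0 ω))) μ μ := fun j => (hε.identDistrib j).comp hf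
  -- The shift by one matches sums over `range n` with averages over `1, …, n`.
  have h := strong_law_ae_real (fun (i : ℕ) ω => Real.exp (inner ℝ t (eps (i + 1 : ℕ) ω)))
    ((hid (0 + 1 : ℕ)).integrable_iff.mpr (hmgf t))
    (fun i j hij => (hε.indep.indepFun (by simpa using hij)).comp hf hf)
    fun i => (hid (i + 1 : ℕ)).trans (hid (0 + 1 : ℕ)).symm
  have hE : ∫ ω, Real.exp (inner ℝ t (eps (0 + 1 : ℕ) ω)) ∂μ = vecMGF μ (eps 0) t :=
    (hid (0 + 1 : ℕ)).integral_eq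
  filter_upwards [h] with ω hω
  refine (hE ▸ hω).congr fun n => ?_
  rw [empMGF, div_eq_inv_mul, Finset.range_eq_Ico,
    Finset.sum_Ico_add' (fun j : ℕ => Real.exp (inner ℝ t (eps j ω))) 0 n 1]
  rfl

/-- Almost sure convergence at each `t` gives convergence in measure for `ν.prod μ`. By Fubini and
Markov, most `ω` then have a small exceptional set of `t`. -/
theorem IsInnovation.tendsto_measure_empMGF [IsProbabilityMeasure μ] (hε : IsInnovation μ eps)
    (hmgf : ∀ t : Vec d, Integrable (fun ω => Real.exp (inner ℝ t (eps 0 ω))) μ)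
    (ν : Measure (Vec d)) [IsFiniteMeasure ν] (r : ℝ) {γ : ℝ} (hγ : 0 < γ) :
    Tendsto (fun n => μ {ω | ENNReal.ofReal γ < ν {t | γ ≤
      ‖empMGF (fun j : ℕ => eps j ω) n (r • t) - vecMGF μ (eps 0) (r • t)‖}}) atTop (𝓝 0) := by
  have hM := continuous_vecMGF hmgf
  let f : ℕ → Vec d × Ω → ℝ := fun n p => empMGF (fun j : ℕ => eps j p.2) n (r • p.1)
  let g : Vec d × Ω → ℝ := fun p => vecMGF μ (eps 0) (r • p.1)
  have hf : ∀ n, Measurable (f n) := by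
    intro n
    refine Measurable.const_mul (Finset.measurable_fun_sum _ fun j _ => ?_) _
    have : Measurable fun p : Vec d × Ω => eps j p.2 := (hε.measurable j).comp measurable_snd
    exact Real.measurable_exp.comp ((measurable_fst.const_smul r).inner this)
  have hg : Measurable g := hM.measurable.comp (measurable_fst.const_smul r)
  have hae : ∀ᵐ p ∂ν.prod μ, Tendsto (fun n => f n p) atTop (𝓝 (g p)) := by
    rw [Measure.ae_prod_iff_ae_ae (measurableSet_tendsto_fun hf hg)]
    exact Eventually.of_forall fun t => hε.ae_tendsto_empMGF hmgf (r • t)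
  have hmeas := tendstoInMeasure_iff_norm.mp
    (tendstoInMeasure_of_tendsto_ae (fun n => (hf n).aestronglyMeasurable) hae) γ hγ
  have hγ0 : ENNReal.ofReal γ ≠ 0 := by simpa using hγ
  have hlim : Tendsto (fun n => (ν.prod μ) {p | γ ≤ ‖f n p - g p‖} / ENNReal.ofReal γ) atTop
      (𝓝 0) := by
    simpa using ENNReal.Tendsto.div_const hmeas (Or.inr hγ0)
  refine tendsto_of_tendsto_of_tendsto_of_le_of_le tendsto_const_nhds hlim
    (fun _ => zero_le) fun n => ?_
  have hA : MeasurableSet {p | γ ≤ ‖f n p - g p‖} :=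
    measurableSet_le measurable_const ((hf n).sub hg).norm
  rw [ENNReal.le_div_iff_mul_le (Or.inl hγ0) (Or.inl ENNReal.ofReal_ne_top), mul_comm,
    Measure.prod_apply_symm hA]
  refine le_trans ?_ (mul_meas_ge_le_lintegral (measurable_measure_prodMk_right hA)
    (ENNReal.ofReal γ))
  refine mul_le_mul_right (measure_mono fun ω hω => ?_) _
  rw [Set.mem_ofPred_eq] at hω
  exact hω.le

end EmpiricalLimit

/-! ### The lower bound and consistency of the test -/

theorem testStat_div_eq {d : ℕ} (β : ℝ) (y : ℕ → Vec d) {n : ℕ} (hn : 1 ≤ n) :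
    testStat β y n / n =
      ∫⁻ t, ENNReal.ofReal ((empMGF y n t - gaussMGF t) ^ 2) ∂(weightMeasure d β) := by
  have hn0 : (n : ℝ≥0∞) ≠ 0 := by exact_mod_cast (by omega : n ≠ 0)
  rw [lintegral_weightMeasure (f := fun t => empMGF y n t - gaussMGF t)
    ((continuous_empMGF y n).sub continuous_gaussMGF)]
  refine (ENNReal.eq_div_iff hn0 (ENNReal.natCast_ne_top n)).mpr ?_ |>.symm
  rw [← lintegral_const_mul' _ _ (ENNReal.natCast_ne_top n), testStat]
  refine (lintegral_congr fun t => ?_).symm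
  rw [← ENNReal.ofReal_natCast n, ← ENNReal.ofReal_mul (Nat.cast_nonneg n), empProcess, mul_pow,
    Real.sq_sqrt (Nat.cast_nonneg n), mul_assoc]

theorem liminfGEInProb_garchStat {d v : ℕ} {Ω : Type*} [MeasurableSpace Ω] {μ : Measure Ω}
    [IsProbabilityMeasure μ] {Θ : Set (Vec v)} {θ₀ : Vec v} (hθ₀ : θ₀ ∈ Θ)
    {S : Vec v → (ℕ → Vec d) → Matrix (Fin d) (Fin d) ℝ} (hS : IsVolatility Θ S)
    {eps X : ℤ → Ω → Vec d} (hε : IsInnovation μ eps) (hX : IsStationaryGARCH μ S θ₀ eps X)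
    {xinit : ℤ → Vec d} {θhat : ℕ → Ω → Vec v} (hθhatΘ : ∀ n ω, θhat n ω ∈ Θ)
    (hA1 : AssumptionA1 μ θ₀ eps θhat) (hA2 : AssumptionA2 μ Θ S xinit X)
    (hA3 : AssumptionA3 μ Θ S xinit X) (hA5 : AssumptionA5 Θ S)
    (hmgf : ∀ t : Vec d, Integrable (fun ω => Real.exp (inner ℝ t (eps 0 ω))) μ)
    {β : ℝ} (hβ : 0 < β) :
    LiminfGEInProb μ (fun n ω => garchStat S xinit X θhat β n ω / n)
      (mgfDistance μ (eps 0) β) := by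
  intro c hc
  have := isFiniteMeasure_weightMeasure (d := d) hβ
  rw [mgfDistance, ← lintegral_weightMeasure (f := fun t => vecMGF μ (eps 0) t - gaussMGF t)
    ((continuous_vecMGF hmgf).sub continuous_gaussMGF)] at hc
  obtain ⟨γ, hγ, hcrit⟩ := exists_pos_forall_lt_lintegral hβ (vecMGF μ (eps 0)) hc
  have h1 := tendsto_measure_card_residual hθ₀ hS hε hX hθhatΘ (hA1.tendstoInMeasure hε) hA2 hA3
    (fun x a b => (hA5 x a b).continuousOn) hγ
  -- The scales `1` and `2` supply the two closeness conditions of the criterion, at `t` and at `2 •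
  -- t`.
  have h2 := hε.tendsto_measure_empMGF hmgf (weightMeasure d β) 1 hγ
  have h3 := hε.tendsto_measure_empMGF hmgf (weightMeasure d β) 2 hγ
  have hsum := (h1.add h2).add h3
  simp only [add_zero, one_smul] at hsum
  refine tendsto_of_tendsto_of_tendsto_of_le_of_le' tendsto_const_nhds hsum
    (Eventually.of_forall fun _ => zero_le) ?_
  filter_upwards [eventually_ge_atTop 1] with n hn
  refine (measure_mono fun ω hω => ?_).trans
    ((measure_union_le _ _).trans (add_le_add (measure_union_le _ _) le_rfl))
  by_contra hcon
  simp only [Set.mem_union, not_or] at hcon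
  obtain ⟨⟨hcard, hone⟩, htwo⟩ := hcon
  refine absurd (hcrit n _ _ (not_lt.mp hcard) (not_lt.mp hone) (not_lt.mp htwo)) (not_lt.mpr ?_)
  rw [← testStat_div_eq β _ hn]
  exact hω

theorem mainTheorem4 {d v : ℕ} {Ω : Type*} [MeasurableSpace Ω] (μ : Measure Ω)
    [IsProbabilityMeasure μ] (Θ : Set (Vec v)) (θ₀ : Vec v) (hθ₀ : θ₀ ∈ Θ)
    (S : Vec v → (ℕ → Vec d) → Matrix (Fin d) (Fin d) ℝ) (hS : IsVolatility Θ S)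
    (eps X : ℤ → Ω → Vec d) (hε : IsInnovation μ eps)
    (hX : IsStationaryGARCH μ S θ₀ eps X)
    (xinit : ℤ → Vec d) (θhat : ℕ → Ω → Vec v) (hθhat : ∀ n, Measurable (θhat n))
    (hθhatΘ : ∀ n ω, θhat n ω ∈ Θ)
    (hA1 : AssumptionA1 μ θ₀ eps θhat)
    (hA2 : AssumptionA2 μ Θ S xinit X)
    (hA3 : AssumptionA3 μ Θ S xinit X)
    (hA4 : AssumptionA4 μ S θ₀ X)
    (hA5 : AssumptionA5 Θ S)
    (hA6 : AssumptionA6 μ Θ S θ₀ X)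
    (hac : μ.map (eps 0) ≪ (volume : Measure (Vec d)))
    (hmgf : ∀ t : Vec d, Integrable (fun ω => Real.exp (inner ℝ t (eps 0 ω))) μ)
    (β : ℝ) (hβ : 1 < β) :
    LiminfGEInProb μ (fun n ω => garchStat S xinit X θhat β n ω / n) (mgfDistance μ (eps 0) β) ∧
    (μ.map (eps 0) ≠ stdGaussian (Vec d) →
      ∀ c : ℕ → ℝ, BddAbove (Set.range c) →
        Tendsto (fun n => μ {ω | garchStat S xinit X θhat β n ω ≤ ENNReal.ofReal (c n)})
          atTop (𝓝 0)) := by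
  have hlim : LiminfGEInProb μ (fun n ω => garchStat S xinit X θhat β n ω / n)
      (mgfDistance μ (eps 0) β) :=
    liminfGEInProb_garchStat hθ₀ hS hε hX hθhatΘ hA1 hA2 hA3 hA5 hmgf (by linarith)
  refine ⟨hlim, fun hne c hc => ?_⟩
  have hpos : 0 < mgfDistance μ (eps 0) β := pos_iff_ne_zero.mpr fun h0 =>
    hne (map_eq_stdGaussian_of_mgfDistance_eq_zero (hε.measurable 0) hmgf h0)
  obtain ⟨κ, hκ0, hκ⟩ := exists_between hpos
  obtain ⟨b, hb⟩ := hc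
  -- Bounded critical values, divided by `n`, eventually drop below the fixed level `κ`, which is
  -- strictly less than the limiting distance.
  have hdiv : Tendsto (fun n : ℕ => ENNReal.ofReal b / n) atTop (𝓝 0) := by
    simpa using ENNReal.Tendsto.const_div (a := ENNReal.ofReal b) ENNReal.tendsto_nat_nhds_top
      (Or.inr ENNReal.ofReal_ne_top)
  refine tendsto_of_tendsto_of_tendsto_of_le_of_le' tendsto_const_nhds (hlim κ hκ)
    (Eventually.of_forall fun _ => zero_le) ?_
  filter_upwards [hdiv.eventually (ge_mem_nhds hκ0)] with n hn
  refine measure_mono fun ω hω => le_trans ?_ hn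
  have hω' : garchStat S xinit X θhat β n ω ≤ ENNReal.ofReal (c n) := hω
  gcongr
  exact hω'.trans (ENNReal.ofReal_le_ofReal (hb ⟨n, rfl⟩))
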